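/- **Setting.** Let $\mathcal T^2$ be the category of pairs $(X,A)$ of compact (Hausdorff) spaces, $A$ closed in $X$, and let $L(X,A)=|X|/|A|$, where $|X|$ is the realization of the singular complex of $X$ (so $L(X,\emptyset)=|X|^+$), with its pairing $\omega_L:L(X,A)\wedge L(Y,B)\to L((X,A)\times(Y,B))$. Let $\iota:I^+\to L(I)$ be the canonical map. Let $F$ be a functor from $\mathcal T^2$ to pointed (compactly generated) spaces with a natural, unital and associative pairing $\omega_F:F(X,A)\wedge L(Y,B)\to F((X,A)\times(Y,B))$ and an augmentation $\varepsilon:L\to F$, i.e. a natural transformation with $\omega_F(\varepsilon\wedge 1)=\varepsilon\,\omega_L$; for example an augmented homology theory. For a homotopy $H:(X,A)\times I\to(Y,B)$ let $\widehat F(H):F(X,A)\wedge I^+\to F(Y,B)$ be the composite $$F(X,A)\wedge I^+\xrightarrow{1\wedge\iota}F(X,A)\wedge L(I)\xrightarrow{\omega_F}F((X,A)\times I)\xrightarrow{F(H)}F(Y,B).$$ For functors $S$, $G$ from a category to pointed spaces, a simplicial transformation $S\wedge P^+\to G$ assigns to each $p$-simplex $C=(C_0\to\dots\to C_p)$ of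 the nerve a map $S(C_0)\wedge P^+\wedge\Delta_p^+\to G(C_p)$, such that for $\alpha:[q]\to[p]$ the restriction of the map of $C$ along $\alpha:\Delta_q\to\Delta_p$ is the map of $\alpha^*C$, precomposed with $S(C_0\to C_{\alpha(0)})$ and composed with $G(C_{\alpha(q)}\to C_p)$. Let $\mathcal B$ be the category of fiberwise smooth bundles $E\downarrow(B,A)$ over compact pairs, with compact smooth manifolds (possibly with boundary) as fibers, and of the bundle maps which are diffeomorphisms on fibers; put $L(E\downarrow(B,A))=L(B,A)$ and $F(E\downarrow(B,A))=F(E,E|A)$. Let $\mathcal D$ be the category of pairs $(E,\Delta)$, where $E\in\mathcal B$ is fiberwise diffeomorphic to an orthogonal disk bundle and $\Delta:B\to E-\dot E$ is a section ($\dot E$ is the fiberwise boundary), and of the maps in $\mathcal B$ which preserve the sections. Let $(T,\mathbf d)$ be a transfer for $F$. Only the following part of its structure is used, and nothing else is required of $(T,\mathbf d)$: 1. $T:L\to F$ is a simplicial transformation on $\mathcal B$; 2. $T$ has a multiplicative structure, i.e. a simplicial homotopy $\mu:L\wedge L\wedge I^+\to F^\times$ on $\mathcal B\times\mathcal T^2$,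 where $F^\times(E,(X,Y))=F(E\times(X,Y))$, from $\omega_F(T\wedge1)$ to $T^\times\omega_L$, where $T^\times(E,(X,Y))=T(E\times(X,Y))$; it is normal: for a one point space $*$, after identification of $E\times *$ with $E$, the homotopy $\mu$ is constant (that is, it is the homotopy which $T$ assigns to the natural isomorphisms $E\to E\times *$); 3. $\mathbf d:L\wedge I^+\to F$ is a simplicial homotopy on $\mathcal D$ from $T$ to the natural transformation $(E,\Delta)\mapsto F(\Delta)\,\varepsilon(B,A)$. In particular, $\mathbf d$ gives a path $\mathbf d(E,\Delta)$ from $T(E)$ to $F(\Delta)\,\varepsilon(B,A)$ in the space of pointed maps $L(B,A)\to F(E,E|A)$ for each $(E,\Delta)$ in $\mathcal D$. **Theorem.** Let $E=E\downarrow(B,A)$ be an orthogonal disk bundle, let $\Delta_0,\Delta_1:B\to E-\dot E$ be sections, and let $\phi:(B,A)\times I\to(E,E|A)$ be the linear path $\phi(b,t)=(1-t)\Delta_0(b)+t\Delta_1(b)$. Then $\widehat F(\phi)(\varepsilon(B,A)\wedge1)$ is a path from $F(\Delta_0)\varepsilon(B,A)$ to $F(\Delta_1)\varepsilon(B,A)$,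 and the path $\mathbf d(E,\Delta_0)$ followed by $\widehat F(\phi)(\varepsilon(B,A)\wedge 1)$ is homotopic, relative to the end points, to the path $\mathbf d(E,\Delta_1)$; that is, the following square of path classes commutes: $$\begin{array}{ccc} T(E)&\xrightarrow{\ 1\ }&T(E)\\ {\scriptstyle \mathbf d(E,\Delta_0)}\downarrow&&\downarrow{\scriptstyle \mathbf d(E,\Delta_1)}\\ F(\Delta_0)\varepsilon(B,A)&\xrightarrow{\widehat F(\phi)(\varepsilon(B,A)\wedge1)}&F(\Delta_1)\varepsilon(B,A) \end{array}$$ -/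

import Mathlib

open CategoryTheory Set Topology unitInterval Bundle
open scoped Manifold ContDiff

namespace RefinedTransfer

/-! ### Spaces

Homotopy theory takes place in compactly generated spaces. We present them as arbitrary topological
spaces together with the `k`-continuous maps: replacing every space by its `k`-ification is an
equivalence of categories, under which cartesian products correspond to `k`-products, and for maps
out of a compactly generated space `k`-continuity is continuity. -/

/-- A map is `k`-continuous if it is continuous along every continuous map from a compact
Hausdorff space. -/
def KContinuous {X Y : Type} [TopologicalSpace X] [TopologicalSpace Y] (f : X → Y) : Prop :=
  ∀ (K : CompHaus.{0}) (u : C(K, X)), Continuous (f ∘ u)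

section KContinuous

variable {X Y Z W : Type} [TopologicalSpace X] [TopologicalSpace Y] [TopologicalSpace Z]
  [TopologicalSpace W]

theorem _root_.Continuous.kContinuous {f : X → Y} (hf : Continuous f) : KContinuous f :=
  fun _ u => hf.comp u.continuous

theorem KContinuous.comp {f : X → Y} {g : Y → Z} (hg : KContinuous g) (hf : KContinuous f) :
    KContinuous (g ∘ f) :=
  fun K u => hg K ⟨f ∘ u, hf K u⟩

theorem KContinuous.prodMk {f : X → Y} {g : X → Z} (hf : KContinuous f) (hg : KContinuous g) :
    KContinuous (fun x => (f x, g x)) :=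
  fun K u => (hf K u).prodMk (hg K u)

theorem KContinuous.prodMap {f : X → Y} {g : Z → W} (hf : KContinuous f) (hg : KContinuous g) :
    KContinuous (Prod.map f g) :=
  (hf.comp continuous_fst.kContinuous).prodMk (hg.comp continuous_snd.kContinuous)

end KContinuous

/-- A pair of compact spaces `(X, A)`; `A` is closed in `X`. -/
structure CompactPair where
  carrier : Type
  [top : TopologicalSpace carrier]
  [compact : CompactSpace carrier]
  [t2 : T2Space carrier]
  sub : Set carrier
  isClosed_sub : IsClosed sub

namespace CompactPair

instance : CoeSort CompactPair Type := ⟨carrier⟩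

attribute [instance] top compact t2

/-- Maps of pairs. -/
@[ext]
structure Hom (X Y : CompactPair) where
  map : C(X, Y)
  mapsTo : MapsTo map X.sub Y.sub

instance : Category CompactPair where
  Hom := Hom
  id X := ⟨ContinuousMap.id X, fun _ h => h⟩
  comp f g := ⟨g.map.comp f.map, fun _ h => g.mapsTo (f.mapsTo h)⟩

/-- `(X, A) × (Y, B) = (X × Y, A × Y ∪ X × B)`. -/
def prod (X Y : CompactPair) : CompactPair where
  carrier := X × Y
  sub := {z | z.1 ∈ X.sub ∨ z.2 ∈ Y.sub}
  isClosed_sub := (X.isClosed_sub.preimage continuous_fst).union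
    (Y.isClosed_sub.preimage continuous_snd)

def prodMap {X X' Y Y' : CompactPair} (f : X ⟶ X') (g : Y ⟶ Y') : X.prod Y ⟶ X'.prod Y' where
  map := f.map.prodMap g.map
  mapsTo := fun _ h => h.imp (fun h => f.mapsTo h) (fun h => g.mapsTo h)

def assoc (X Y Z : CompactPair) : X.prod (Y.prod Z) ⟶ (X.prod Y).prod Z where
  map := ⟨fun z => ((z.1, z.2.1), z.2.2), by fun_prop⟩
  mapsTo := fun _ h => or_assoc.2 h

/-- The one point pair `(*, ∅)`. -/
def pt : CompactPair where
  carrier := PUnit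
  sub := ∅
  isClosed_sub := isClosed_empty

def unitor (X : CompactPair) : X.prod pt ⟶ X where
  map := ⟨Prod.fst, continuous_fst⟩
  mapsTo := fun _ h => h.resolve_right (fun h => h)

/-- The pair `(I, ∅)`. -/
def interval : CompactPair where
  carrier := I
  sub := ∅
  isClosed_sub := isClosed_empty

/-- The inclusion `X → X × I` at the time `t`. -/
def atTime (X : CompactPair) (t : I) : X ⟶ X.prod interval where
  map := ⟨fun x => (x, t), by fun_prop⟩
  mapsTo := fun _ h => Or.inl h

end CompactPair

/-- A pair `(X, X₀)` which presents the pointed space `X / X₀` (this is `X⁺` if `X₀ = ∅`): a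
pointed map `X / X₀ → Z` is a map `X → Z` which sends `X₀` to the base point. The smash product of
`X / X₀` and `Y / Y₀` is presented by `(X × Y, X₀ × Y ∪ X × Y₀)`. -/
structure SpacePair where
  carrier : Type
  [top : TopologicalSpace carrier]
  sub : Set carrier

namespace SpacePair

instance : CoeSort SpacePair Type := ⟨carrier⟩

attribute [instance] top

@[ext]
structure Hom (X Y : SpacePair) where
  map : X → Y
  kcont : KContinuous map
  mapsTo : MapsTo map X.sub Y.sub

instance : Category SpacePair where
  Hom := Hom
  id X := ⟨id, continuous_id.kContinuous, fun _ h => h⟩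
  comp f g := ⟨g.map ∘ f.map, g.kcont.comp f.kcont, fun _ h => g.mapsTo (f.mapsTo h)⟩

def smash (X Y : SpacePair) : SpacePair where
  carrier := X × Y
  sub := {z | z.1 ∈ X.sub ∨ z.2 ∈ Y.sub}

def smashMap {X X' Y Y' : SpacePair} (f : X ⟶ X') (g : Y ⟶ Y') : X.smash Y ⟶ X'.smash Y' where
  map := Prod.map f.map g.map
  kcont := f.kcont.prodMap g.kcont
  mapsTo := fun _ h => h.imp (fun h => f.mapsTo h) (fun h => g.mapsTo h)

end SpacePair

/-- Pointed spaces. -/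
structure PointedSpace where
  carrier : Type
  [top : TopologicalSpace carrier]
  pt : carrier

namespace PointedSpace

instance : CoeSort PointedSpace Type := ⟨carrier⟩

attribute [instance] top

@[ext]
structure Hom (X Y : PointedSpace) where
  map : X → Y
  kcont : KContinuous map
  map_pt : map X.pt = Y.pt

instance : Category PointedSpace where
  Hom := Hom
  id X := ⟨id, continuous_id.kContinuous, rfl⟩
  comp f g := ⟨g.map ∘ f.map, g.kcont.comp f.kcont, by
    simp only [Function.comp_apply, f.map_pt, g.map_pt]⟩

end PointedSpace

/-! ### The functor `L` -/

/-- `|X|`, the geometric realization of the singular complex of `X`. -/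
abbrev Realization (X : Type) [TopologicalSpace X] : Type :=
  SSet.toTop.obj (TopCat.toSSet.obj (TopCat.of X))

/-- The map `|f| : |X| → |Y|`. -/
noncomputable def Realization.map {X Y : Type} [TopologicalSpace X] [TopologicalSpace Y]
    (f : C(X, Y)) : C(Realization X, Realization Y) :=
  (SSet.toTop.map (TopCat.toSSet.map (TopCat.ofHom f))).hom

theorem Realization.map_id (X : Type) [TopologicalSpace X] (x : Realization X) :
    Realization.map (ContinuousMap.id X) x = x := by
  have : TopCat.ofHom (ContinuousMap.id X) = 𝟙 (TopCat.of X) := rfl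
  simp [Realization.map, this]

theorem Realization.map_comp {X Y Z : Type} [TopologicalSpace X] [TopologicalSpace Y]
    [TopologicalSpace Z] (f : C(X, Y)) (g : C(Y, Z)) (x : Realization X) :
    Realization.map (g.comp f) x = Realization.map g (Realization.map f x) := by
  have : TopCat.ofHom (g.comp f) = TopCat.ofHom f ≫ TopCat.ofHom g := rfl
  simp [Realization.map, this]

/-- The point of `|X|` which corresponds to the point `t` of a singular simplex `s`. -/
noncomputable def Realization.mk {X : Type} [TopologicalSpace X] {n : ℕ}
    (s : C(stdSimplex ℝ (Fin (n + 1)), X)) (t : stdSimplex ℝ (Fin (n + 1))) : Realization X :=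
  SSet.toTop.map (SSet.yonedaEquiv.symm
    ((TopCat.toSSetObjEquiv (TopCat.of X) (Opposite.op (SimplexCategory.mk n))).symm s))
    (SSet.toTopSimplex.inv.app (SimplexCategory.mk n) (ULift.up t))

theorem Realization.continuous_mk {X : Type} [TopologicalSpace X] {n : ℕ}
    (s : C(stdSimplex ℝ (Fin (n + 1)), X)) : Continuous (Realization.mk s) :=
  (SSet.toTop.map (SSet.yonedaEquiv.symm
    ((TopCat.toSSetObjEquiv (TopCat.of X) (Opposite.op (SimplexCategory.mk n))).symm s))).hom.continuous.comp
    ((SSet.toTopSimplex.inv.app (SimplexCategory.mk n)).hom.continuous.comp continuous_uliftUp)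

theorem Realization.map_mk {X Y : Type} [TopologicalSpace X] [TopologicalSpace Y] (f : C(X, Y)) {n : ℕ}
    (s : C(stdSimplex ℝ (Fin (n + 1)), X)) (t : stdSimplex ℝ (Fin (n + 1))) :
    Realization.map f (Realization.mk s t) = Realization.mk (f.comp s) t := by
  have h : SSet.yonedaEquiv.symm
    ((TopCat.toSSetObjEquiv (TopCat.of X) (Opposite.op (SimplexCategory.mk n))).symm s) ≫
     TopCat.toSSet.map (TopCat.ofHom f) = SSet.yonedaEquiv.symm
    ((TopCat.toSSetObjEquiv (TopCat.of Y) (Opposite.op (SimplexCategory.mk n))).symm (f.comp s)) := by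
    apply SSet.yonedaEquiv.injective
    rw [SSet.yonedaEquiv_comp, Equiv.apply_symm_apply, Equiv.apply_symm_apply]
    rfl
  simp only [Realization.map, Realization.mk, ← h, Functor.map_comp]
  rfl

theorem Realization.mk_map {X : Type} [TopologicalSpace X] {m n : ℕ}
    (s : C(stdSimplex ℝ (Fin (n + 1)), X)) (α : Fin (m + 1) →o Fin (n + 1))
    (t : stdSimplex ℝ (Fin (m + 1))) :
    Realization.mk s (stdSimplex.map α t) =
      Realization.mk (s.comp ⟨stdSimplex.map α, stdSimplex.continuous_map α⟩) t := by
  have h : SSet.stdSimplex.map (SimplexCategory.mkHom α) ≫ SSet.yonedaEquiv.symm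
    ((TopCat.toSSetObjEquiv (TopCat.of X) (Opposite.op (SimplexCategory.mk n))).symm s)
     = SSet.yonedaEquiv.symm
    ((TopCat.toSSetObjEquiv (TopCat.of X) (Opposite.op (SimplexCategory.mk m))).symm (s.comp ⟨stdSimplex.map α, stdSimplex.continuous_map α⟩)) := by
    apply SSet.yonedaEquiv.injective
    rw [SSet.yonedaEquiv_comp, Equiv.apply_symm_apply]
    rfl
  simp only [Realization.mk, ← h, Functor.map_comp]
  have h2 := SSet.toTopSimplex.inv.naturality (SimplexCategory.mkHom α)
  have h3 := congrArg (fun f => f (ULift.up t)) h2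
  exact congrArg _ h3

/-- The functor `L(X, A) = |X| / |A|`.

The natural map `|X × Y| → |X| × |Y|`, `w ↦ (|pr₁| w, |pr₂| w)`, is an isomorphism, and the pairing
`ω_L : L(X, A) ∧ L(Y, B) → L((X, A) × (Y, B))` is its inverse. An identity which contains
`ω_L (x, y)` is stated below for all `w` in `|X × Y|`, with `x = |pr₁| w` and `y = |pr₂| w`. -/
noncomputable def L : CompactPair ⥤ SpacePair where
  obj X := ⟨Realization X,
    range (Realization.map (⟨Subtype.val, continuous_subtype_val⟩ : C(X.sub, X)))⟩
  map {X Y} f := ⟨Realization.map f.map, (Realization.map f.map).continuous.kContinuous, by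
    rintro _ ⟨a, rfl⟩
    refine ⟨Realization.map ⟨fun a : X.sub => (⟨f.map a, f.mapsTo a.2⟩ : Y.sub), by fun_prop⟩ a, ?_⟩
    rw [← Realization.map_comp, ← Realization.map_comp]
    rfl⟩
  map_id X := SpacePair.Hom.ext (funext fun x => Realization.map_id X x)
  map_comp f g := SpacePair.Hom.ext (funext fun x => Realization.map_comp f.map g.map x)

/-- `|pr₁| : |X × Y| → |X|`. -/
noncomputable def pr₁ {X Y : CompactPair} : Realization (X.prod Y) → Realization X :=
  Realization.map ⟨Prod.fst, continuous_fst⟩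

/-- `|pr₂| : |X × Y| → |Y|`. -/
noncomputable def pr₂ {X Y : CompactPair} : Realization (X.prod Y) → Realization Y :=
  Realization.map ⟨Prod.snd, continuous_snd⟩

/-- The canonical map `ι : I → |I| = L(I)`, given by the singular `1`-simplex `Δ₁ ≅ I`. -/
noncomputable def iota (t : I) : L.obj CompactPair.interval :=
  Realization.mk (X := I) (stdSimplexHomeomorphUnitInterval : C(stdSimplex ℝ (Fin 2), I))
    (stdSimplexHomeomorphUnitInterval.symm t)

theorem continuous_iota : Continuous iota :=
  (Realization.continuous_mk _).comp stdSimplexHomeomorphUnitInterval.symm.continuous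

/-- The inclusion `* → I` of the point `t`. -/
def CompactPair.point (t : I) : CompactPair.pt ⟶ CompactPair.interval where
  map := ⟨fun _ => t, continuous_const⟩
  mapsTo _ h := h.elim

theorem iota_vertex (j : Fin 2) (t : I)
    (ht : t = stdSimplexHomeomorphUnitInterval (stdSimplex.vertex j)) :
    ∃ y, (L.map (CompactPair.point t)).map y = iota t := by
  refine ⟨Realization.mk (X := PUnit) (n := 0) ⟨fun _ => ⟨⟩, continuous_const⟩ default, ?_⟩
  have h1 : stdSimplexHomeomorphUnitInterval.symm t =
      stdSimplex.map (⟨fun _ => j, monotone_const⟩ : Fin 1 →o Fin 2)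
        (default : stdSimplex ℝ (Fin 1)) := by
    rw [ht, Homeomorph.symm_apply_apply, Subsingleton.elim default (stdSimplex.vertex 0),
      stdSimplex.map_vertex]
    rfl
  have h2 : (stdSimplexHomeomorphUnitInterval : C(stdSimplex ℝ (Fin 2), I)).comp
      ⟨stdSimplex.map (⟨fun _ => j, monotone_const⟩ : Fin 1 →o Fin 2),
        stdSimplex.continuous_map _⟩ =
      (⟨fun _ => t, continuous_const⟩ : C(PUnit, I)).comp
        (⟨fun _ => ⟨⟩, continuous_const⟩ : C(stdSimplex ℝ (Fin (0 + 1)), PUnit)) := by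
    ext u
    rw [Subsingleton.elim u default]
    change (stdSimplexHomeomorphUnitInterval (stdSimplex.map _ default) : ℝ) = t
    rw [← h1, Homeomorph.apply_symm_apply]
  rw [iota, h1, Realization.mk_map, h2]
  exact Realization.map_mk (X := PUnit) (Y := I) _ _ _

/-! ### Augmented multiplicative functors -/

/-- A multiplicative functor `(F, ω)` from pairs of compact spaces to pointed spaces, together with
an augmentation `ε : L → F`. -/
structure AugmentedMultiplicativeFunctor where
  F : CompactPair ⥤ PointedSpace
  /-- The pairing `ω : F(X, A) ∧ L(Y, B) → F((X, A) × (Y, B))`. -/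
  pairing : ∀ {X Y : CompactPair}, F.obj X → L.obj Y → F.obj (X.prod Y)
  pairing_kcont : ∀ {X Y : CompactPair},
    KContinuous (fun z : F.obj X × L.obj Y => (pairing z.1 z.2 : F.obj (X.prod Y)))
  pairing_pt : ∀ {X Y : CompactPair} (y : L.obj Y), pairing (F.obj X).pt y = (F.obj (X.prod Y)).pt
  pairing_sub : ∀ {X Y : CompactPair} (x : F.obj X) (y : L.obj Y), y ∈ (L.obj Y).sub →
    pairing x y = (F.obj (X.prod Y)).pt
  pairing_natural : ∀ {X X' Y Y' : CompactPair} (f : X ⟶ X') (g : Y ⟶ Y') (x : F.obj X) (y : L.obj Y),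
    (F.map (CompactPair.prodMap f g)).map (pairing x y) = pairing ((F.map f).map x) ((L.map g).map y)
  pairing_unit : ∀ {X : CompactPair} (x : F.obj X) (y : L.obj CompactPair.pt),
    (F.map X.unitor).map (pairing x y) = x
  pairing_assoc : ∀ {X Y Z : CompactPair} (x : F.obj X) (w : L.obj (Y.prod Z)),
    (F.map (CompactPair.assoc X Y Z)).map (pairing x w) = pairing (pairing x (pr₁ w)) (pr₂ w)
  /-- The augmentation `ε : L(X, A) → F(X, A)`. -/
  aug : ∀ {X : CompactPair}, L.obj X → F.obj X
  aug_kcont : ∀ {X : CompactPair}, KContinuous (aug : L.obj X → F.obj X)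
  aug_sub : ∀ {X : CompactPair} (x : L.obj X), x ∈ (L.obj X).sub → aug x = (F.obj X).pt
  aug_natural : ∀ {X Y : CompactPair} (f : X ⟶ Y) (x : L.obj X),
    (F.map f).map (aug x) = aug ((L.map f).map x)
  aug_mul : ∀ {X Y : CompactPair} (w : L.obj (X.prod Y)), pairing (aug (pr₁ w)) (pr₂ w) = aug w

/-! ### Smooth families of maps -/

/-- For a family `g b : M → M'`, `b ∈ P`, of maps between smooth manifolds, the iterated tangent
maps `Tʲ(g b)`, `j ≤ k`, exist on `S` and depend continuously on the point and on `b`. -/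
def SmoothFamilyUpTo (P : Type) [TopologicalSpace P] : ℕ →
    ∀ {V : Type} [NormedAddCommGroup V] [NormedSpace ℝ V] {H : Type} [TopologicalSpace H]
      (J : ModelWithCorners ℝ V H) {M : Type} [TopologicalSpace M] [ChartedSpace H M]
      [IsManifold J ∞ M]
      {V' : Type} [NormedAddCommGroup V'] [NormedSpace ℝ V'] {H' : Type} [TopologicalSpace H']
      (J' : ModelWithCorners ℝ V' H') {M' : Type} [TopologicalSpace M'] [ChartedSpace H' M']
      [IsManifold J' ∞ M'],
      Set M → (P → M → M') → Prop
  | 0, _, _, _, _, _, _, _, _, _, _, _, _, _, _, _, _, _, _, _, _, S, g =>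
      ContinuousOn (fun z : P × _ => g z.1 z.2) (univ ×ˢ S)
  | k + 1, _, _, _, _, _, J, _, _, _, _, _, _, _, _, _, J', _, _, _, _, S, g =>
      ContinuousOn (fun z : P × _ => g z.1 z.2) (univ ×ˢ S) ∧
      (∀ b, MDifferentiableOn J J' (g b) S) ∧
      SmoothFamilyUpTo P k J.tangent J'.tangent (TotalSpace.proj ⁻¹' S)
        (fun b => tangentMapWithin J J' (g b) S)

section SmoothFamily

variable {P Q : Type} [TopologicalSpace P] [TopologicalSpace Q]
  {V : Type} [NormedAddCommGroup V] [NormedSpace ℝ V] {H : Type} [TopologicalSpace H]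
  {J : ModelWithCorners ℝ V H} {M : Type} [TopologicalSpace M] [ChartedSpace H M]
  [IsManifold J ∞ M]
  {V' : Type} [NormedAddCommGroup V'] [NormedSpace ℝ V'] {H' : Type} [TopologicalSpace H']
  {J' : ModelWithCorners ℝ V' H'} {M' : Type} [TopologicalSpace M'] [ChartedSpace H' M']
  [IsManifold J' ∞ M']
  {V'' : Type} [NormedAddCommGroup V''] [NormedSpace ℝ V''] {H'' : Type} [TopologicalSpace H'']
  {J'' : ModelWithCorners ℝ V'' H''} {M'' : Type} [TopologicalSpace M''] [ChartedSpace H'' M'']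
  [IsManifold J'' ∞ M'']

theorem SmoothFamilyUpTo.congr {k : ℕ} {S : Set M} {g h : P → M → M'}
    (hg : SmoothFamilyUpTo P k J J' S g) (e : ∀ b, EqOn (h b) (g b) S) :
    SmoothFamilyUpTo P k J J' S h := by
  have key : ∀ {M M' : Type} [TopologicalSpace M] [TopologicalSpace M'] {S : Set M}
      {g h : P → M → M'}, ContinuousOn (fun z : P × M => g z.1 z.2) (univ ×ˢ S) →
      (∀ b, EqOn (h b) (g b) S) → ContinuousOn (fun z : P × M => h z.1 z.2) (univ ×ˢ S) := by
    intro M M' _ _ S g h hg e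
    exact hg.congr fun z hz => e z.1 hz.2
  induction k generalizing V H M V' H' M' with
  | zero => exact key hg e
  | succ k ih =>
    refine ⟨key hg.1 e, fun b => (hg.2.1 b).congr (e b), ih hg.2.2 fun b z hz => ?_⟩
    have h1 := e b (x := z.1) hz
    have h2 : mfderivWithin J J' (h b) S z.1 = mfderivWithin J J' (g b) S z.1 :=
      mfderivWithin_congr (e b) h1
    have h3 : ∀ (x y : M') (w : V'), x = y → (⟨x, w⟩ : TangentBundle J' M') = ⟨y, w⟩ := by
      rintro x _ w rfl
      rfl
    simp only [tangentMapWithin, h2]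
    exact h3 _ _ _ h1

theorem SmoothFamilyUpTo.reparam {k : ℕ} {S : Set M} {g : P → M → M'}
    (hg : SmoothFamilyUpTo P k J J' S g) {r : Q → P} (hr : Continuous r) :
    SmoothFamilyUpTo Q k J J' S (fun b => g (r b)) := by
  have key : ∀ {M M' : Type} [TopologicalSpace M] [TopologicalSpace M'] {S : Set M}
      {g : P → M → M'}, ContinuousOn (fun z : P × M => g z.1 z.2) (univ ×ˢ S) →
      ContinuousOn (fun z : Q × M => g (r z.1) z.2) (univ ×ˢ S) := by
    intro M M' _ _ S g h
    exact h.comp (f := fun z : Q × M => (r z.1, z.2)) (by fun_prop) fun z hz => ⟨mem_univ _, hz.2⟩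
  induction k generalizing V H M V' H' M' with
  | zero => exact key hg
  | succ k ih => exact ⟨key hg.1, fun b => hg.2.1 (r b), ih hg.2.2⟩

theorem SmoothFamilyUpTo.of_local {k : ℕ} {S : Set M} {g : P → M → M'}
    (h : ∀ b, ∃ O : Set P, IsOpen O ∧ b ∈ O ∧
      SmoothFamilyUpTo O k J J' S (fun c : O => g c)) :
    SmoothFamilyUpTo P k J J' S g := by
  have key : ∀ {M M' : Type} [TopologicalSpace M] [TopologicalSpace M'] {S : Set M}
      {g : P → M → M'}, (∀ b, ∃ O : Set P, IsOpen O ∧ b ∈ O ∧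
        ContinuousOn (fun z : O × M => g z.1 z.2) (univ ×ˢ S)) →
      ContinuousOn (fun z : P × M => g z.1 z.2) (univ ×ˢ S) := by
    intro M M' _ _ S g h
    refine continuousOn_of_locally_continuousOn fun z hz => ?_
    obtain ⟨O, hO, hb, hc⟩ := h z.1
    refine ⟨O ×ˢ univ, hO.prod isOpen_univ, ⟨hb, mem_univ _⟩, ?_⟩
    rw [continuousOn_iff_continuous_domRestrict] at hc ⊢
    let r : ((univ ×ˢ S) ∩ (O ×ˢ univ) : Set (P × M)) → ((univ : Set O) ×ˢ S : Set (O × M)) :=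
      fun w => ⟨(⟨w.1.1, w.2.2.1⟩, w.1.2), mem_univ _, w.2.1.2⟩
    exact hc.comp (show Continuous r by fun_prop)
  induction k generalizing V H M V' H' M' with
  | zero => exact key h
  | succ k ih =>
    refine ⟨key fun b => ?_, fun b => ?_, ih fun b => ?_⟩
    · obtain ⟨O, hO, hb, hc⟩ := h b
      exact ⟨O, hO, hb, hc.1⟩
    · obtain ⟨O, hO, hb, hc⟩ := h b
      exact hc.2.1 ⟨b, hb⟩
    · obtain ⟨O, hO, hb, hc⟩ := h b
      exact ⟨O, hO, hb, hc.2.2⟩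

theorem SmoothFamilyUpTo.comp {k : ℕ} {S : Set M} {S' : Set M'} {g : P → M → M'}
    {h : P → M' → M''} (hS : UniqueMDiffOn J S) (hh : SmoothFamilyUpTo P k J' J'' S' h)
    (hg : SmoothFamilyUpTo P k J J' S g) (hm : ∀ b, MapsTo (g b) S S') :
    SmoothFamilyUpTo P k J J'' S (fun b => h b ∘ g b) := by
  have key : ∀ {M M' M'' : Type} [TopologicalSpace M] [TopologicalSpace M'] [TopologicalSpace M'']
      {S : Set M} {S' : Set M'} {g : P → M → M'} {h : P → M' → M''},
      ContinuousOn (fun z : P × M' => h z.1 z.2) (univ ×ˢ S') →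
      ContinuousOn (fun z : P × M => g z.1 z.2) (univ ×ˢ S) →
      (∀ b, MapsTo (g b) S S') →
      ContinuousOn (fun z : P × M => h z.1 (g z.1 z.2)) (univ ×ˢ S) := by
    intro M M' M'' _ _ _ S S' g h hh hg hm
    exact hh.comp (f := fun z : P × M => (z.1, g z.1 z.2)) (continuousOn_fst.prodMk hg)
      fun z hz => ⟨mem_univ _, hm _ hz.2⟩
  induction k generalizing V H M V' H' M' V'' H'' M'' with
  | zero => exact key hh hg hm
  | succ k ih =>
    refine ⟨key hh.1 hg.1 hm, fun b => (hh.2.1 b).comp (hg.2.1 b) (hm b), ?_⟩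
    refine (ih hS.tangentBundle_proj_preimage hh.2.2 hg.2.2 fun b z hz => hm b hz).congr ?_
    intro b z hz
    exact tangentMapWithin_comp_at z (hh.2.1 b _ (hm b hz)) (hg.2.1 b _ hz) (hm b) (hS _ hz)

variable (J J') in
/-- `g` is a family of smooth maps on `S ⊆ M`, continuous in the `C^∞` topology: all derivatives
in the direction of `M` exist and are jointly continuous in the point and the parameter. -/
def SmoothFamilyOn (S : Set M) (g : P → M → M') : Prop :=
  (∀ b, ContMDiffOn J J' ∞ (g b) S) ∧ ∀ k, SmoothFamilyUpTo P k J J' S g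

theorem SmoothFamilyOn.congr {S : Set M} {g h : P → M → M'} (hg : SmoothFamilyOn J J' S g)
    (e : ∀ b, EqOn (h b) (g b) S) : SmoothFamilyOn J J' S h :=
  ⟨fun b => (hg.1 b).congr (e b), fun k => (hg.2 k).congr e⟩

theorem SmoothFamilyOn.reparam {S : Set M} {g : P → M → M'} (hg : SmoothFamilyOn J J' S g)
    {r : Q → P} (hr : Continuous r) : SmoothFamilyOn J J' S (fun b => g (r b)) :=
  ⟨fun b => hg.1 (r b), fun k => (hg.2 k).reparam hr⟩

theorem SmoothFamilyOn.of_local {S : Set M} {g : P → M → M'}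
    (h : ∀ b, ∃ O : Set P, IsOpen O ∧ b ∈ O ∧ SmoothFamilyOn J J' S (fun c : O => g c)) :
    SmoothFamilyOn J J' S g := by
  refine ⟨fun b => ?_, fun k => .of_local fun b => ?_⟩ <;> obtain ⟨O, hO, hb, hc⟩ := h b
  · exact hc.1 ⟨b, hb⟩
  · exact ⟨O, hO, hb, hc.2 k⟩

theorem SmoothFamilyOn.comp {S : Set M} {S' : Set M'} {g : P → M → M'} {h : P → M' → M''}
    (hS : UniqueMDiffOn J S) (hh : SmoothFamilyOn J' J'' S' h) (hg : SmoothFamilyOn J J' S g)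
    (hm : ∀ b, MapsTo (g b) S S') : SmoothFamilyOn J J'' S (fun b => h b ∘ g b) :=
  ⟨fun b => (hh.1 b).comp (hg.1 b) (hm b), fun k => (hh.2 k).comp hS (hg.2 k) hm⟩

end SmoothFamily


/-! ### Fiberwise smooth bundles -/

/-- The model of `n`-dimensional manifolds with boundary: the half space, a point if `n = 0`. -/
def HalfSpace : ℕ → Type
  | 0 => EuclideanSpace ℝ (Fin 0)
  | n + 1 => EuclideanHalfSpace (n + 1)

instance : ∀ n, TopologicalSpace (HalfSpace n)
  | 0 => inferInstanceAs (TopologicalSpace (EuclideanSpace ℝ (Fin 0)))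
  | n + 1 => inferInstanceAs (TopologicalSpace (EuclideanHalfSpace (n + 1)))

noncomputable def halfModel : ∀ n, ModelWithCorners ℝ (EuclideanSpace ℝ (Fin n)) (HalfSpace n)
  | 0 => 𝓘(ℝ, EuclideanSpace ℝ (Fin 0))
  | n + 1 => 𝓡∂ (n + 1)

/-- Compact smooth manifolds with (possibly empty) boundary. -/
structure CompactManifold where
  dim : ℕ
  carrier : Type
  [top : TopologicalSpace carrier]
  [compact : CompactSpace carrier]
  [t2 : T2Space carrier]
  [charted : ChartedSpace (HalfSpace dim) carrier]
  [smooth : IsManifold (halfModel dim) ∞ carrier]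

namespace CompactManifold

instance : CoeSort CompactManifold Type := ⟨carrier⟩

attribute [instance] top compact t2 charted smooth

noncomputable abbrev model (M : CompactManifold) :
    ModelWithCorners ℝ (EuclideanSpace ℝ (Fin M.dim)) (HalfSpace M.dim) := halfModel M.dim

end CompactManifold

/-- A fiberwise smooth bundle `E ↓ (B, A)` with compact fibers: a locally trivial bundle with an
atlas of local trivializations `E|U ≅ U × M`, `M` a compact smooth manifold with boundary, whose
transition functions are continuous families of smooth maps. (That the total space is compact and
Hausdorff follows from the other fields.) -/
structure SmoothBundle where
  base : CompactPair
  total : Type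
  [top : TopologicalSpace total]
  [compact : CompactSpace total]
  [t2 : T2Space total]
  proj : C(total, base)
  idx : Type
  fib : idx → CompactManifold
  triv : ∀ i, Trivialization (fib i) proj
  cover : ∀ b, ∃ i, b ∈ (triv i).baseSet
  transition : ∀ i j, SmoothFamilyOn (fib i).model (fib j).model univ
    (fun (b : {b : base // b ∈ (triv i).baseSet ∧ b ∈ (triv j).baseSet}) (m : fib i) =>
      (triv j ((triv i).toOpenPartialHomeomorph.symm (b.1, m))).2)

namespace SmoothBundle

attribute [instance] top compact t2

/-- The map `m ↦ f (b, m)` in local trivializations. -/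
def localRep {E E' : SmoothBundle} (f : E.total → E'.total) (i : E.idx) (j : E'.idx)
    (b : E.base) (m : E.fib i) : E'.fib j :=
  (E'.triv j (f ((E.triv i).toOpenPartialHomeomorph.symm (b, m)))).2

/-- Maps `(f̃, f) : E ↓ (B, A) → E' ↓ (B', A')` of bundles which are diffeomorphisms on the
fibers. -/
@[ext]
structure Hom (E E' : SmoothBundle) where
  base : E.base ⟶ E'.base
  total : C(E.total, E'.total)
  comm : ∀ e, E'.proj (total e) = base.map (E.proj e)
  smooth : ∀ i j, SmoothFamilyOn (E.fib i).model (E'.fib j).model univ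
    (fun (b : {b : E.base // b ∈ (E.triv i).baseSet ∧ base.map b ∈ (E'.triv j).baseSet}) =>
      localRep total i j b.1)
  diffeo : ∀ i j b, b ∈ (E.triv i).baseSet → base.map b ∈ (E'.triv j).baseSet →
    ∃ Φ : Diffeomorph (E.fib i).model (E'.fib j).model (E.fib i) (E'.fib j) ∞,
      ∀ m, Φ m = localRep total i j b m

theorem proj_symm (E : SmoothBundle) {i : E.idx} {b : E.base} (hb : b ∈ (E.triv i).baseSet)
    (m : E.fib i) : E.proj ((E.triv i).toOpenPartialHomeomorph.symm (b, m)) = b :=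
  (E.triv i).proj_symm_apply' hb

theorem localRep_comp {E E' E'' : SmoothBundle} {f : C(E.total, E'.total)}
    {g : C(E'.total, E''.total)} {φ : C(E.base, E'.base)}
    (hf : ∀ e, E'.proj (f e) = φ (E.proj e)) {i : E.idx} (j : E'.idx) (k : E''.idx) {b : E.base}
    (hi : b ∈ (E.triv i).baseSet) (hj : φ b ∈ (E'.triv j).baseSet) (m : E.fib i) :
    localRep (g.comp f) i k b m = localRep g j k (φ b) (localRep f i j b m) := by
  have h1 : E'.proj (f ((E.triv i).toOpenPartialHomeomorph.symm (b, m))) = φ b := by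
    rw [hf, E.proj_symm hi]
  have h2 := (E'.triv j).symm_apply_mk_proj
    (x := f ((E.triv i).toOpenPartialHomeomorph.symm (b, m))) ((E'.triv j).mem_source.2 (h1 ▸ hj))
  rw [h1] at h2
  simp only [localRep, h2, ContinuousMap.comp_apply]

theorem diffeo_id (E : SmoothBundle) (i j : E.idx) (b : E.base) (hi : b ∈ (E.triv i).baseSet)
    (hj : b ∈ (E.triv j).baseSet) :
    ∃ Φ : Diffeomorph (E.fib i).model (E.fib j).model (E.fib i) (E.fib j) ∞,
      ∀ m, Φ m = localRep (E := E) (E' := E) id i j b m :=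
  have key : ∀ {i j : E.idx}, b ∈ (E.triv i).baseSet → b ∈ (E.triv j).baseSet → ∀ m,
      localRep (E := E) (E' := E) id j i b (localRep (E := E) (E' := E) id i j b m) = m := by
    intro i j hi hj m
    have h := localRep_comp (E := E) (E' := E) (E'' := E) (f := ContinuousMap.id _)
      (g := ContinuousMap.id _) (φ := ContinuousMap.id _) (fun _ => rfl) j i hi hj m
    refine Eq.trans h.symm ?_
    simp only [localRep, ContinuousMap.comp_id, ContinuousMap.id_apply,
      (E.triv i).apply_symm_apply' hi]
  ⟨{  toFun := localRep (E := E) (E' := E) id i j b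
      invFun := localRep (E := E) (E' := E) id j i b
      left_inv := key hi hj
      right_inv := key hj hi
      contMDiff_toFun := contMDiffOn_univ.1 ((E.transition i j).1 ⟨b, hi, hj⟩)
      contMDiff_invFun := contMDiffOn_univ.1 ((E.transition j i).1 ⟨b, hj, hi⟩) },
    fun _ => rfl⟩

instance : Category SmoothBundle where
  Hom := Hom
  id E :=
    { base := 𝟙 E.base
      total := ContinuousMap.id _
      comm := fun _ => rfl
      smooth := E.transition
      diffeo := E.diffeo_id }
  comp {E E' E''} f g :=
    { base := f.base ≫ g.base
      total := g.total.comp f.total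
      comm := fun e => (g.comm _).trans (congrArg g.base.map (f.comm e))
      smooth := fun i k => .of_local fun b => by
        obtain ⟨j, hj⟩ := E'.cover (f.base.map b.1)
        refine ⟨{c | f.base.map c.1 ∈ (E'.triv j).baseSet},
          (E'.triv j).open_baseSet.preimage (f.base.map.continuous.comp continuous_subtype_val),
          hj, ?_⟩
        have hg := (g.smooth j k).reparam (Q := {c : {c : E.base // c ∈ (E.triv i).baseSet ∧
            (f.base ≫ g.base).map c ∈ (E''.triv k).baseSet} |
            f.base.map c.1 ∈ (E'.triv j).baseSet})
          (r := fun c => ⟨f.base.map c.1.1, c.2, c.1.2.2⟩) (by fun_prop)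
        have hf := (f.smooth i j).reparam (Q := {c : {c : E.base // c ∈ (E.triv i).baseSet ∧
            (f.base ≫ g.base).map c ∈ (E''.triv k).baseSet} |
            f.base.map c.1 ∈ (E'.triv j).baseSet})
          (r := fun c => ⟨c.1.1, c.1.2.1, c.2⟩) (by fun_prop)
        exact (hg.comp uniqueMDiffOn_univ hf fun _ _ _ => mem_univ _).congr fun c m _ =>
          localRep_comp f.comm j k c.1.2.1 c.2 m
      diffeo := fun i k b hi hk => by
        obtain ⟨j, hj⟩ := E'.cover (f.base.map b)
        obtain ⟨Φ, hΦ⟩ := f.diffeo i j b hi hj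
        obtain ⟨Ψ, hΨ⟩ := g.diffeo j k (f.base.map b) hj hk
        refine ⟨Φ.trans Ψ, fun m => ?_⟩
        rw [localRep_comp f.comm j k hi hj]
        simp [hΦ, hΨ] }

/-- The pair `(E, E|A)`. -/
def totalPair (E : SmoothBundle) : CompactPair where
  carrier := E.total
  sub := E.proj ⁻¹' E.base.sub
  isClosed_sub := E.base.isClosed_sub.preimage E.proj.continuous

/-- The local trivialization of `E × X` given by one of `E`. -/
def timesTriv {B Z M : Type} [TopologicalSpace B] [TopologicalSpace Z] [TopologicalSpace M]
    {p : Z → B} (e : Trivialization M p) (X : Type) [TopologicalSpace X] :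
    Trivialization M (Prod.map p (id : X → X)) where
  toFun z := ((p z.1, z.2), (e z.1).2)
  invFun w := (e.toOpenPartialHomeomorph.symm (w.1.1, w.2), w.1.2)
  source := (p ⁻¹' e.baseSet) ×ˢ univ
  target := (e.baseSet ×ˢ univ) ×ˢ univ
  baseSet := e.baseSet ×ˢ univ
  map_source' z hz := ⟨⟨hz.1, mem_univ _⟩, mem_univ _⟩
  map_target' w hw := ⟨by
    rw [mem_preimage, e.proj_symm_apply' hw.1.1]
    exact hw.1.1, mem_univ _⟩
  left_inv' z hz := Prod.ext (e.symm_apply_mk_proj (e.mem_source.2 hz.1)) rfl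
  right_inv' w hw := by
    have h := hw.1.1
    refine Prod.ext (Prod.ext (e.proj_symm_apply' h) rfl) ?_
    have h2 := e.apply_symm_apply' h (x := w.2)
    change (e (e.toOpenPartialHomeomorph.symm (w.1.1, w.2))).2 = w.2
    rw [h2]
  open_source := by
    rw [← e.source_eq]
    exact e.open_source.prod isOpen_univ
  open_target := (e.open_baseSet.prod isOpen_univ).prod isOpen_univ
  continuousOn_toFun := by
    have h : ContinuousOn (fun z : Z × X => e z.1) ((p ⁻¹' e.baseSet) ×ˢ univ) :=
      e.continuousOn_toFun.comp continuousOn_fst fun z hz => e.mem_source.2 hz.1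
    have h' : ContinuousOn (fun z : Z × X => p z.1) ((p ⁻¹' e.baseSet) ×ˢ univ) :=
      h.fst.congr fun z hz => (e.coe_fst (e.mem_source.2 hz.1)).symm
    exact (h'.prodMk continuousOn_snd).prodMk h.snd
  continuousOn_invFun := by
    have h : ContinuousOn (fun w : (B × X) × M => e.toOpenPartialHomeomorph.symm (w.1.1, w.2))
        ((e.baseSet ×ˢ univ) ×ˢ univ) :=
      e.continuousOn_invFun.comp (f := fun w : (B × X) × M => (w.1.1, w.2)) (by fun_prop)
        fun w hw => e.mem_target.2 hw.1.1
    exact h.prodMk (by fun_prop)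
  open_baseSet := e.open_baseSet.prod isOpen_univ
  source_eq := by ext z; simp
  target_eq := rfl
  proj_toFun _ _ := rfl

/-- The product `E × X ↓ (B, A) × (X, Y)`. -/
def times (E : SmoothBundle) (X : CompactPair) : SmoothBundle where
  base := E.base.prod X
  total := E.total × X
  proj := E.proj.prodMap (ContinuousMap.id X)
  idx := E.idx
  fib := E.fib
  triv i := timesTriv (E.triv i) X
  cover b := (E.cover b.1).imp fun _ h => ⟨h, mem_univ _⟩
  transition i j := (E.transition i j).reparam
    (r := fun b : {b : E.base × X // b ∈ (E.triv i).baseSet ×ˢ univ ∧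
      b ∈ (E.triv j).baseSet ×ˢ univ} => ⟨b.1.1, b.2.1.1, b.2.2.1⟩) (by fun_prop)

def timesMap {E E' : SmoothBundle} {X X' : CompactPair} (f : E ⟶ E') (g : X ⟶ X') :
    E.times X ⟶ E'.times X' where
  base := CompactPair.prodMap f.base g
  total := f.total.prodMap g.map
  comm e := Prod.ext (f.comm e.1) rfl
  smooth i j := (f.smooth i j).reparam
    (r := fun b : {b : E.base × X // b ∈ (E.triv i).baseSet ×ˢ univ ∧
      (f.base.map b.1, g.map b.2) ∈ (E'.triv j).baseSet ×ˢ univ} =>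
        ⟨b.1.1, b.2.1.1, b.2.2.1⟩) (by fun_prop)
  diffeo i j b hi hj := f.diffeo i j b.1 hi.1 hj.1

/-- The functor `×`, which makes the category of bundles multiplicative. -/
def timesFunctor : SmoothBundle × CompactPair ⥤ SmoothBundle where
  obj C := C.1.times C.2
  map f := timesMap f.1 f.2

/-- The natural isomorphism `E → E × *`. -/
def toTimesPt : 𝟭 SmoothBundle ⟶ Functor.prod' (𝟭 _) ((Functor.const _).obj CompactPair.pt) ⋙
    timesFunctor where
  app E :=
    { base := ⟨⟨fun b => (b, PUnit.unit), by fun_prop⟩, fun _ h => Or.inl h⟩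
      total := ⟨fun e => (e, PUnit.unit), by fun_prop⟩
      comm := fun _ => rfl
      smooth := fun i j => (E.transition i j).reparam
        (r := fun b : {b : E.base // b ∈ (E.triv i).baseSet ∧
          (b, PUnit.unit) ∈ (E.triv j).baseSet ×ˢ (univ : Set PUnit)} => ⟨b.1, b.2.1, b.2.2.1⟩)
        (by fun_prop)
      diffeo := fun i j b hi hj => E.diffeo_id i j b hi hj.1 }

/-- The functor `E ↓ (B, A) ↦ (B, A)`. -/
def baseFunctor : SmoothBundle ⥤ CompactPair where
  obj E := E.base
  map f := f.base

/-- The functor `E ↓ (B, A) ↦ (E, E|A)`. -/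
def totalFunctor : SmoothBundle ⥤ CompactPair where
  obj E := E.totalPair
  map {E E'} f := ⟨f.total, fun e he => by
    have h : f.base.map (E.proj e) ∈ E'.base.sub := f.base.mapsTo he
    exact (congrArg (· ∈ E'.base.sub) (f.comm e)).mpr h⟩

/-- The fiberwise boundary `Ė`. -/
def boundary (E : SmoothBundle) : Set E.total :=
  {e | ∃ i, E.proj e ∈ (E.triv i).baseSet ∧
    (E.triv i e).2 ∈ (E.fib i).model.boundary (E.fib i)}

/-- Sections `B → E - Ė`. -/
structure InteriorSection (E : SmoothBundle) where
  map : C(E.base, E.total)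
  proj_map : ∀ b, E.proj (map b) = b
  not_mem : ∀ b, map b ∉ E.boundary

/-- A section, as a map of pairs `(B, A) → (E, E|A)`. -/
def InteriorSection.pairMap {E : SmoothBundle} (Δ : E.InteriorSection) :
    E.base ⟶ E.totalPair where
  map := Δ.map
  mapsTo b hb := by
    have h := Δ.proj_map b
    exact (congrArg (· ∈ E.base.sub) h).mpr hb

end SmoothBundle

/-! ### Orthogonal disk bundles -/

/-- The unit disk in `ℝⁿ`. -/
abbrev disk (n : ℕ) : Set (EuclideanSpace ℝ (Fin n)) := Metric.closedBall 0 1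

/-- The structure of an orthogonal disk bundle on `E`: local trivializations `E|U ≅ U × Dⁿ` which
are fiberwise diffeomorphisms, with transition functions in the orthogonal group. -/
structure OrthogonalDiskStructure (E : SmoothBundle) where
  idx : Type
  rank : idx → ℕ
  chart : ∀ k, Trivialization (disk (rank k)) E.proj
  cover : ∀ b, ∃ k, b ∈ (chart k).baseSet
  smooth : ∀ i k, SmoothFamilyOn (E.fib i).model 𝓘(ℝ, EuclideanSpace ℝ (Fin (rank k))) univ
    (fun (b : {b : E.base // b ∈ (E.triv i).baseSet ∧ b ∈ (chart k).baseSet}) m =>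
      ((chart k ((E.triv i).toOpenPartialHomeomorph.symm (b.1, m))).2 :
        EuclideanSpace ℝ (Fin (rank k))))
  smooth_symm : ∀ i k,
    ∃ h : {b : E.base // b ∈ (E.triv i).baseSet ∧ b ∈ (chart k).baseSet} →
        EuclideanSpace ℝ (Fin (rank k)) → E.fib i,
      SmoothFamilyOn 𝓘(ℝ, EuclideanSpace ℝ (Fin (rank k))) (E.fib i).model (disk (rank k)) h ∧
      ∀ b (v : disk (rank k)),
        h b v = (E.triv i ((chart k).toOpenPartialHomeomorph.symm (b.1, v))).2
  orthogonal : ∀ k l b, b ∈ (chart k).baseSet → b ∈ (chart l).baseSet →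
    ∃ A : EuclideanSpace ℝ (Fin (rank k)) ≃ₗᵢ[ℝ] EuclideanSpace ℝ (Fin (rank l)),
      ∀ e, E.proj e = b →
        ((chart l e).2 : EuclideanSpace ℝ (Fin (rank l))) = A (chart k e).2

namespace OrthogonalDiskStructure

variable {E : SmoothBundle} (D : OrthogonalDiskStructure E) (Δ₀ Δ₁ : E.InteriorSection)

/-- The point `(1 - t) x + t y` of the disk. -/
def lerp {n : ℕ} (x y : disk n) (t : I) : disk n :=
  ⟨(1 - t : ℝ) • (x : EuclideanSpace ℝ (Fin n)) + (t : ℝ) • (y : EuclideanSpace ℝ (Fin n)),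
    convex_closedBall _ _ x.2 y.2 (sub_nonneg.2 t.2.2) t.2.1 (by ring)⟩

/-- The point `(1 - t) Δ₀(b) + t Δ₁(b)`, computed in the `k`-th chart. -/
def linearPathIn (k : D.idx) (b : E.base) (t : I) : E.total :=
  (D.chart k).toOpenPartialHomeomorph.symm
    (b, lerp (D.chart k (Δ₀.map b)).2 (D.chart k (Δ₁.map b)).2 t)

theorem proj_linearPathIn {k : D.idx} {b : E.base} (hk : b ∈ (D.chart k).baseSet) (t : I) :
    E.proj (D.linearPathIn Δ₀ Δ₁ k b t) = b :=
  (D.chart k).proj_symm_apply' hk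

theorem linearPathIn_eq {k l : D.idx} {b : E.base} (hk : b ∈ (D.chart k).baseSet)
    (hl : b ∈ (D.chart l).baseSet) (t : I) :
    D.linearPathIn Δ₀ Δ₁ k b t = D.linearPathIn Δ₀ Δ₁ l b t := by
  obtain ⟨A, hA⟩ := D.orthogonal k l b hk hl
  have hp := D.proj_linearPathIn Δ₀ Δ₁ hk t
  have h1 : (D.chart k (D.linearPathIn Δ₀ Δ₁ k b t)).2 =
      lerp (D.chart k (Δ₀.map b)).2 (D.chart k (Δ₁.map b)).2 t := by
    rw [linearPathIn, (D.chart k).apply_symm_apply' hk]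
  have h2 : (D.chart l (D.linearPathIn Δ₀ Δ₁ k b t)).2 =
      lerp (D.chart l (Δ₀.map b)).2 (D.chart l (Δ₁.map b)).2 t := by
    apply Subtype.ext
    rw [hA _ hp, h1]
    simp only [lerp, map_add, map_smul, hA _ (Δ₀.proj_map b), hA _ (Δ₁.proj_map b)]
  have h3 := (D.chart l).symm_apply_mk_proj (x := D.linearPathIn Δ₀ Δ₁ k b t)
    ((D.chart l).mem_source.2 (hp.symm ▸ hl))
  rw [hp, h2] at h3
  exact h3.symm

theorem continuousOn_linearPathIn (k : D.idx) :
    ContinuousOn (fun z : E.base × I => D.linearPathIn Δ₀ Δ₁ k z.1 z.2)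
      ((D.chart k).baseSet ×ˢ univ) := by
  have h : ∀ Δ : E.InteriorSection, ContinuousOn (fun z : E.base × I =>
      ((D.chart k (Δ.map z.1)).2 : EuclideanSpace ℝ (Fin (D.rank k))))
      ((D.chart k).baseSet ×ˢ univ) := by
    intro Δ
    have h : ContinuousOn (fun z : E.base × I => D.chart k (Δ.map z.1))
        ((D.chart k).baseSet ×ˢ univ) :=
      (D.chart k).continuousOn_toFun.comp (by fun_prop) fun z hz =>
        (D.chart k).mem_source.2 ((Δ.proj_map z.1).symm ▸ hz.1)
    exact continuous_subtype_val.comp_continuousOn h.snd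
  refine (D.chart k).continuousOn_invFun.comp (f := fun z : E.base × I =>
    (z.1, lerp (D.chart k (Δ₀.map z.1)).2 (D.chart k (Δ₁.map z.1)).2 z.2)) ?_
    fun z hz => (D.chart k).mem_target.2 hz.1
  refine continuousOn_fst.prodMk (Topology.IsInducing.subtypeVal.continuousOn_iff.2 ?_)
  exact ((by fun_prop : Continuous (fun z : E.base × I => (1 - z.2 : ℝ))).continuousOn.smul
    (h Δ₀)).add ((by fun_prop : Continuous (fun z : E.base × I => (z.2 : ℝ))).continuousOn.smul
    (h Δ₁))

theorem linearPathIn_zero {k : D.idx} {b : E.base} (hk : b ∈ (D.chart k).baseSet) :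
    D.linearPathIn Δ₀ Δ₁ k b 0 = Δ₀.map b := by
  have h := (D.chart k).symm_apply_mk_proj (x := Δ₀.map b)
    ((D.chart k).mem_source.2 ((Δ₀.proj_map b).symm ▸ hk))
  rw [Δ₀.proj_map] at h
  have e : lerp (D.chart k (Δ₀.map b)).2 (D.chart k (Δ₁.map b)).2 0 =
      (D.chart k (Δ₀.map b)).2 := Subtype.ext (by simp [lerp])
  rw [linearPathIn, e, h]

theorem linearPathIn_one {k : D.idx} {b : E.base} (hk : b ∈ (D.chart k).baseSet) :
    D.linearPathIn Δ₀ Δ₁ k b 1 = Δ₁.map b := by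
  have h := (D.chart k).symm_apply_mk_proj (x := Δ₁.map b)
    ((D.chart k).mem_source.2 ((Δ₁.proj_map b).symm ▸ hk))
  rw [Δ₁.proj_map] at h
  have e : lerp (D.chart k (Δ₀.map b)).2 (D.chart k (Δ₁.map b)).2 1 =
      (D.chart k (Δ₁.map b)).2 := Subtype.ext (by simp [lerp])
  rw [linearPathIn, e, h]

/-- The linear path `φ(b, t) = (1 - t) Δ₀(b) + t Δ₁(b)`, as a map of pairs
`(B, A) × I → (E, E|A)`. -/
noncomputable def linearPath : E.base.prod CompactPair.interval ⟶ E.totalPair where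
  map := ⟨fun z => D.linearPathIn Δ₀ Δ₁ (D.cover z.1).choose z.1 z.2, by
    refine continuous_iff_continuousAt.2 fun z => ?_
    obtain ⟨k, hk⟩ := D.cover z.1
    have hO : (D.chart k).baseSet ×ˢ univ ∈ 𝓝 z :=
      ((D.chart k).open_baseSet.prod isOpen_univ).mem_nhds ⟨hk, mem_univ _⟩
    refine ((D.continuousOn_linearPathIn Δ₀ Δ₁ k).continuousAt hO).congr ?_
    filter_upwards [hO] with w hw
    exact D.linearPathIn_eq Δ₀ Δ₁ hw.1 (D.cover w.1).choose_spec w.2⟩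
  mapsTo z hz := by
    have h := D.proj_linearPathIn Δ₀ Δ₁ (D.cover z.1).choose_spec z.2
    exact (congrArg (· ∈ E.base.sub) h).mpr (hz.resolve_right fun h => h)

theorem linearPath_zero : E.base.atTime 0 ≫ D.linearPath Δ₀ Δ₁ = Δ₀.pairMap :=
  CompactPair.Hom.ext (ContinuousMap.ext fun b =>
    D.linearPathIn_zero Δ₀ Δ₁ (D.cover b).choose_spec)

theorem linearPath_one : E.base.atTime 1 ≫ D.linearPath Δ₀ Δ₁ = Δ₁.pairMap :=
  CompactPair.Hom.ext (ContinuousMap.ext fun b =>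
    D.linearPathIn_one Δ₀ Δ₁ (D.cover b).choose_spec)

end OrthogonalDiskStructure

/-- The objects `(E ↓ (B, A), Δ)`, where `E` is diffeomorphic to an orthogonal disk bundle and `Δ`
is a section of `E - Ė`. -/
structure SectionedDiskBundle where
  bundle : SmoothBundle
  isDisk : Nonempty (OrthogonalDiskStructure bundle)
  sec : bundle.InteriorSection

namespace SectionedDiskBundle

/-- Fiberwise diffeomorphisms which preserve the section. -/
@[ext]
structure Hom (X Y : SectionedDiskBundle) where
  hom : X.bundle ⟶ Y.bundle
  comm : ∀ b, hom.total (X.sec.map b) = Y.sec.map (hom.base.map b)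

instance : Category SectionedDiskBundle where
  Hom := Hom
  id X := ⟨𝟙 X.bundle, fun _ => rfl⟩
  comp f g := ⟨f.hom ≫ g.hom, fun b =>
    (congrArg g.hom.total (f.comm b)).trans (g.comm (f.hom.base.map b))⟩

def forget : SectionedDiskBundle ⥤ SmoothBundle where
  obj X := X.bundle
  map f := f.hom

end SectionedDiskBundle

/-! ### Simplicial transformations -/

/-- A simplicial transformation `T : F ∧ P⁺ → G` on the nerve of `𝒞`: to each `p`-simplex
`C = (C₀ → ⋯ → C_p)` it assigns a map `T(C) : F(C₀) ∧ P⁺ ∧ Δ_p⁺ → G(C_p)`, compatibly with the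
simplicial operators `α : [q] → [p]`. -/
structure SimplicialTransformation {𝒞 : Type 1} [Category.{0} 𝒞] (F : 𝒞 ⥤ SpacePair) (P : Type)
    [TopologicalSpace P] (G : 𝒞 ⥤ PointedSpace) where
  app : ∀ {p : ℕ} (C : Fin (p + 1) ⥤ 𝒞), F.obj (C.obj 0) → P → stdSimplex ℝ (Fin (p + 1)) →
    G.obj (C.obj (Fin.last p))
  kcont : ∀ {p : ℕ} (C : Fin (p + 1) ⥤ 𝒞),
    KContinuous (fun z : F.obj (C.obj 0) × P × stdSimplex ℝ (Fin (p + 1)) =>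
      app C z.1 z.2.1 z.2.2)
  app_sub : ∀ {p : ℕ} (C : Fin (p + 1) ⥤ 𝒞) x u t, x ∈ (F.obj (C.obj 0)).sub →
    app C x u t = (G.obj (C.obj (Fin.last p))).pt
  app_map : ∀ {p q : ℕ} (C : Fin (p + 1) ⥤ 𝒞) (α : Fin (q + 1) →o Fin (p + 1)) x u t,
    app C x u (stdSimplex.map α t) =
      (G.map (C.map (homOfLE (Fin.le_last (α (Fin.last q)))))).map
        (app (α.monotone.functor ⋙ C) ((F.map (C.map (homOfLE (Fin.zero_le (α 0))))).map x) u t)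

/-! ### Paths -/

/-- A path, i.e. a homotopy `K ∧ I⁺ → Z`, from `f` to `g` in the space of pointed maps
`K → Z`. -/
@[ext]
structure MapPath {K : SpacePair} {Z : PointedSpace} (f g : K → Z) where
  map : K → I → Z
  kcont : KContinuous (fun z : K × I => map z.1 z.2)
  map_sub : ∀ x t, x ∈ K.sub → map x t = Z.pt
  source : ∀ x, map x 0 = f x
  target : ∀ x, map x 1 = g x

namespace MapPath

variable {K : SpacePair} {Z : PointedSpace} {f g h : K → Z}

/-- The composite path: first `α`, then `β`. -/
noncomputable def trans (α : MapPath f g) (β : MapPath g h) : MapPath f h where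
  map x t := if (t : ℝ) ≤ 1 / 2 then α.map x (projIcc 0 1 zero_le_one (2 * t))
    else β.map x (projIcc 0 1 zero_le_one (2 * t - 1))
  kcont K u := by
    refine Continuous.if_le (α.kcont K ⟨fun z => ((u z).1, projIcc 0 1 zero_le_one
      (2 * (u z).2 : ℝ)), by fun_prop⟩) (β.kcont K ⟨fun z => ((u z).1, projIcc 0 1 zero_le_one
      (2 * (u z).2 - 1 : ℝ)), by fun_prop⟩) (by fun_prop) (by fun_prop) fun z hz => ?_
    have h1 : (2 * (u z).2 : ℝ) = 1 := by linarith
    have h2 : (2 * (u z).2 - 1 : ℝ) = 0 := by linarith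
    have h3 : projIcc 0 1 zero_le_one (2 * (u z).2 : ℝ) = (1 : I) := by rw [h1, projIcc_right]; rfl
    have h4 : projIcc 0 1 zero_le_one (2 * (u z).2 - 1 : ℝ) = (0 : I) := by
      rw [h2, projIcc_left]; rfl
    simp only [h3, h4, α.target, β.source]
  map_sub x t hx := by
    split_ifs
    · exact α.map_sub x _ hx
    · exact β.map_sub x _ hx
  source x := by
    have h : projIcc 0 1 zero_le_one (2 * (0 : I) : ℝ) = (0 : I) := by simp [projIcc_left]
    rw [if_pos (by simp), h, α.source]
  target x := by
    have h : projIcc 0 1 zero_le_one (2 * (1 : I) - 1 : ℝ) = (1 : I) := by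
      norm_num [projIcc_right]
    rw [if_neg (by norm_num), h, β.target]

/-- The paths `α` and `β` are homotopic relative to their end points, i.e. they lie in the same
component of the space of paths from `f` to `g` and define the same path class. -/
def Homotopic (α β : MapPath f g) : Prop :=
  ∃ Γ : K → I → I → Z,
    KContinuous (fun z : K × I × I => Γ z.1 z.2.1 z.2.2) ∧
    (∀ x t s, x ∈ K.sub → Γ x t s = Z.pt) ∧
    (∀ x t, Γ x t 0 = α.map x t) ∧ (∀ x t, Γ x t 1 = β.map x t) ∧
    (∀ x s, Γ x 0 s = f x) ∧ (∀ x s, Γ x 1 s = g x)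

end MapPath

/-! ### Transfers -/

namespace AugmentedMultiplicativeFunctor

variable (F : AugmentedMultiplicativeFunctor)

/-- For a homotopy `H : (X, A) × I → (Y, B)`, the homotopy
`F̂(H) : F(X, A) ∧ I⁺ → F(X, A) ∧ L(I) → F((X, A) × I) → F(Y, B)`. -/
noncomputable def hat {X Y : CompactPair} (H : X.prod CompactPair.interval ⟶ Y) (x : F.F.obj X)
    (t : I) : F.F.obj Y :=
  (F.F.map H).map (F.pairing x (iota t))

theorem pairing_point {X : CompactPair} (x : F.F.obj X) (t : I) (y : L.obj CompactPair.pt) :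
    F.pairing x ((L.map (CompactPair.point t)).map y) = (F.F.map (X.atTime t)).map x := by
  have h1 := F.pairing_natural (𝟙 X) (CompactPair.point t) x y
  have h2 := F.pairing_unit x y
  have h3 : CompactPair.prodMap (𝟙 X) (CompactPair.point t) = X.unitor ≫ X.atTime t := rfl
  rw [h3, F.F.map_comp, F.F.map_id] at h1
  refine h1.symm.trans ?_
  exact congrArg (F.F.map (X.atTime t)).map h2

theorem hat_vertex {X Y : CompactPair} (H : X.prod CompactPair.interval ⟶ Y) (x : F.F.obj X)
    (j : Fin 2) (t : I) (ht : t = stdSimplexHomeomorphUnitInterval (stdSimplex.vertex j)) :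
    F.hat H x t = (F.F.map (X.atTime t ≫ H)).map x := by
  obtain ⟨y, hy⟩ := iota_vertex j t ht
  rw [hat, ← hy, F.pairing_point, F.F.map_comp]
  rfl

theorem hat_zero {X Y : CompactPair} (H : X.prod CompactPair.interval ⟶ Y) (x : F.F.obj X) :
    F.hat H x 0 = (F.F.map (X.atTime 0 ≫ H)).map x :=
  F.hat_vertex H x 0 0 rfl

theorem hat_one {X Y : CompactPair} (H : X.prod CompactPair.interval ⟶ Y) (x : F.F.obj X) :
    F.hat H x 1 = (F.F.map (X.atTime 1 ≫ H)).map x :=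
  F.hat_vertex H x 1 1 rfl

/-- The path `F̂(H)(ε ∧ 1)` from `F(H₀) ε` to `F(H₁) ε`. -/
noncomputable def hatPath {X Y : CompactPair} (H : X.prod CompactPair.interval ⟶ Y)
    {f g : X ⟶ Y} (hf : X.atTime 0 ≫ H = f) (hg : X.atTime 1 ≫ H = g) :
    MapPath (K := L.obj X) (Z := F.F.obj Y) (fun x => (F.F.map f).map (F.aug x))
      (fun x => (F.F.map g).map (F.aug x)) where
  map x t := F.hat H (F.aug x) t
  kcont := (F.F.map H).kcont.comp (F.pairing_kcont.comp
    ((F.aug_kcont.comp continuous_fst.kContinuous).prodMk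
      (continuous_iota.comp continuous_snd).kContinuous))
  map_sub x t hx := by
    rw [hat, F.aug_sub x hx, F.pairing_pt, (F.F.map H).map_pt]
  source x := by
    rw [← hf]
    exact F.hat_zero H _
  target x := by
    rw [← hg]
    exact F.hat_one H _

end AugmentedMultiplicativeFunctor

/-- The functor `L(E ↓ (B, A)) = L(B, A)`. -/
noncomputable abbrev bundleL : SmoothBundle ⥤ SpacePair := SmoothBundle.baseFunctor ⋙ L

/-- The functor `L ∧ L (E ↓ (B, A), (X, Y)) = L(B, A) ∧ L(X, Y)`. -/
noncomputable def bundleLL : SmoothBundle × CompactPair ⥤ SpacePair where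
  obj C := (L.obj C.1.base).smash (L.obj C.2)
  map f := SpacePair.smashMap (L.map f.1.base) (L.map f.2)
  map_id C := by
    rw [show (𝟙 C : C ⟶ C).1.base = 𝟙 C.1.base from rfl, show (𝟙 C : C ⟶ C).2 = 𝟙 C.2 from rfl,
      L.map_id, L.map_id]
    rfl
  map_comp f g := by
    rw [show (f ≫ g).1.base = f.1.base ≫ g.1.base from rfl,
      show (f ≫ g).2 = f.2 ≫ g.2 from rfl, L.map_comp, L.map_comp]
    rfl

/-- The functor `F(E ↓ (B, A)) = F(E, E|A)`. -/
abbrev AugmentedMultiplicativeFunctor.onBundles (F : AugmentedMultiplicativeFunctor) :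
    SmoothBundle ⥤ PointedSpace := SmoothBundle.totalFunctor ⋙ F.F

/-- The prism `[1] × [p] → 𝒞` with the simplex `C = (C₀ → ⋯ → C_p)` at one end, the simplex
`C × * = (C₀ × * → ⋯ → C_p × *)` at the other end, and the natural isomorphisms between them. -/
def unitPrism {p : ℕ} (C : Fin (p + 1) ⥤ SmoothBundle) : Fin 2 × Fin (p + 1) ⥤ SmoothBundle :=
  Functor.uncurry.obj (ComposableArrows.mk₁ (Functor.whiskerLeft C SmoothBundle.toTimesPt))

/-- The part of a transfer for `F` which concerns single bundles `E` (that is, the bundle pairs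
`∅ < E`). A transfer has in addition values on filtered bundles `E₀ < ⋯ < E_p`, and it satisfies
additivity and other axioms; none of them is required here. -/
structure AbsoluteTransfer (F : AugmentedMultiplicativeFunctor) where
  /-- The transfer maps `T(E) : L(B, A) → F(E, E|A)`, as a simplicial transformation. -/
  T : SimplicialTransformation bundleL PUnit F.onBundles
  /-- The multiplicative structure of `T`, a simplicial homotopy `L ∧ L ∧ I⁺ → F^×` from
  `ω_F (T ∧ 1)` to `T^× ω_L`. -/
  μ : SimplicialTransformation bundleLL I (SmoothBundle.timesFunctor ⋙ F.onBundles)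
  μ_zero : ∀ {p : ℕ} (C : Fin (p + 1) ⥤ SmoothBundle × CompactPair)
    (x : L.obj (C.obj 0).1.base) (y : L.obj (C.obj 0).2) (t : stdSimplex ℝ (Fin (p + 1))),
    μ.app C (x, y) 0 t = F.pairing (T.app (C ⋙ CategoryTheory.Prod.fst _ _) x ⟨⟩ t)
      ((L.map (C.map (homOfLE (Fin.zero_le (Fin.last p)))).2).map y)
  μ_one : ∀ {p : ℕ} (C : Fin (p + 1) ⥤ SmoothBundle × CompactPair)
    (w : L.obj ((C.obj 0).1.base.prod (C.obj 0).2)) (t : stdSimplex ℝ (Fin (p + 1))),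
    μ.app C (pr₁ w, pr₂ w) 1 t = T.app (C ⋙ SmoothBundle.timesFunctor) w ⟨⟩ t
  /-- Normality: for one point spaces `*`, the homotopy `μ` is constant up to the identification of
  `C` with `C × *`. So it is the homotopy which `T` assigns to the isomorphisms `C → C × *`; it is
  evaluated at the point of `I × Δ_p` with coordinates `r` in the simplex
  `γ = (γ₁, γ₂) : [q] → [1] × [p]` of the prism. -/
  μ_unit : ∀ {p q : ℕ} (C : Fin (p + 1) ⥤ SmoothBundle) (γ₁ : Fin (q + 1) →o Fin 2)
    (γ₂ : Fin (q + 1) →o Fin (p + 1)) (x : L.obj (C.obj 0).base) (y : L.obj CompactPair.pt)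
    (r : stdSimplex ℝ (Fin (q + 1))),
    μ.app (C.prod' ((Functor.const _).obj CompactPair.pt)) (x, y)
        (stdSimplexHomeomorphUnitInterval (stdSimplex.map γ₁ r)) (stdSimplex.map γ₂ r) =
      (F.onBundles.map ((unitPrism C).map
        (Prod.mkHom (homOfLE (Fin.le_last (γ₁ (Fin.last q))) : _ ⟶ (1 : Fin 2))
          (homOfLE (Fin.le_last (γ₂ (Fin.last q))))))).map
        (T.app (γ₁.monotone.functor.prod' γ₂.monotone.functor ⋙ unitPrism C)
          ((bundleL.map ((unitPrism C).map
            (Prod.mkHom (homOfLE (Fin.zero_le (γ₁ 0)) : (0 : Fin 2) ⟶ _)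
              (homOfLE (Fin.zero_le (γ₂ 0)))))).map x) ⟨⟩ r)
  /-- The disk bundle paths, a simplicial homotopy `𝐝 : L ∧ I⁺ → F` on the category of disk
  bundles with a section, from `T` to the natural transformation `d(E, Δ) = F(Δ) ε(B, A)`. -/
  d : SimplicialTransformation (SectionedDiskBundle.forget ⋙ bundleL) I
    (SectionedDiskBundle.forget ⋙ F.onBundles)
  d_zero : ∀ {p : ℕ} (C : Fin (p + 1) ⥤ SectionedDiskBundle)
    (x : L.obj (C.obj 0).bundle.base) (t : stdSimplex ℝ (Fin (p + 1))),
    d.app C x 0 t = T.app (C ⋙ SectionedDiskBundle.forget) x ⟨⟩ t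
  d_one : ∀ {p : ℕ} (C : Fin (p + 1) ⥤ SectionedDiskBundle)
    (x : L.obj (C.obj 0).bundle.base) (t : stdSimplex ℝ (Fin (p + 1))),
    d.app C x 1 t = (F.F.map (C.obj (Fin.last p)).sec.pairMap).map
      (F.aug ((L.map (C.map (homOfLE (Fin.zero_le (Fin.last p)))).hom.base).map x))

namespace AbsoluteTransfer

variable {F : AugmentedMultiplicativeFunctor} (𝒯 : AbsoluteTransfer F)

/-- The map `T(E) : L(B, A) → F(E, E|A)`. -/
def onBundle (E : SmoothBundle) (x : L.obj E.base) : F.F.obj E.totalPair :=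
  𝒯.T.app (ComposableArrows.mk₀ E) x ⟨⟩ (default : stdSimplex ℝ (Fin 1))

/-- The path `𝐝(E, Δ)` from `T(E)` to `F(Δ) ε(B, A)`. -/
def dPath (X : SectionedDiskBundle) :
    MapPath (K := L.obj X.bundle.base) (Z := F.F.obj X.bundle.totalPair) (𝒯.onBundle X.bundle)
      (fun x => (F.F.map X.sec.pairMap).map (F.aug x)) where
  map x t := 𝒯.d.app (ComposableArrows.mk₀ X) x t (default : stdSimplex ℝ (Fin 1))
  kcont := (𝒯.d.kcont (ComposableArrows.mk₀ X)).comp (f := fun z : L.obj X.bundle.base × I =>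
    (z.1, z.2, (default : stdSimplex ℝ (Fin 1)))) (by fun_prop : Continuous _).kContinuous
  map_sub x t hx := 𝒯.d.app_sub (ComposableArrows.mk₀ X) x t _ hx
  source x := 𝒯.d_zero (ComposableArrows.mk₀ X) x _
  target x := by
    refine (𝒯.d_one (ComposableArrows.mk₀ X) x default).trans ?_
    change _ = (F.F.map X.sec.pairMap).map (F.aug x)
    have h : (L.map (𝟙 X.bundle.base)).map x = x := by
      rw [L.map_id]
      rfl
    exact congrArg (fun y => (F.F.map X.sec.pairMap).map (F.aug y)) h

end AbsoluteTransfer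

end RefinedTransfer

open RefinedTransfer

/-! The linear path between the two sections is itself a section of the disk bundle E × I, namely
(b, t) ↦ (φ(b, t), t). It avoids the fiberwise boundary because the open ball is convex
(`linearSection`). Hence the transfer has a disk bundle path on E × I. Restrict it to the points
ω_L(x, ι t) and project E × I to E. This gives a square in (t, s). Its edge at s = 1 is F̂(φ)(ε ∧
1), since ε is multiplicative. Its edge at s = 0 is the path t ↦ T(E × I)(ω_L(x, ι t)), called
`cylPath`. Its two other edges are the restrictions `dEndPath` of the disk bundle path to t = 0 and
t = 1.

It remains to compare T(E × I) with T(E). The homotopy μ for (E, I), at (x, ι t) and projected to E,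
is a second square. At s = 0 it is constant, because the projection cancels the pairing with ι t; at
s = 1 it is `cylPath`; its other edges are `muPath 0` and `muPath 1`. So `muPath 0` followed by
`cylPath` is `muPath 1` (`muPath_trans_cylPath`).

The two squares are joined by `muPath_trans_dEndPath`: at either end, `muPath t` followed by
`dEndPath` is 𝐝(E, Δ). Evaluating μ on (E, *) → (E, I) and using normality on (E, *), one finds that
`muPath t` is T(E → E × *) followed by T(E × * → E × I). The 2-simplex E → E × * → E × I contracts
this to T(E → E × I), and 𝐝 on the edge (E, Δ) → (E × I, linear section) turns that path followed by
`dEndPath` into 𝐝(E, Δ).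

All this needs (x, t) ↦ ω_L(x, ι t) as a continuous map |X| × I → |X × I|. It is built by
triangulating the prisms Δ_n × I. -/

namespace RefinedTransfer

/-! ### The map `|X| × I → |X × I|` -/

/-! ### Tail sums of barycentric coordinates. -/

section Mass

variable {X Y : Type} [Fintype X] [Fintype Y]

/-- The total weight which a point of the simplex gives to the vertices satisfying `p`. -/
noncomputable def mass (p : X → Prop) (s : stdSimplex ℝ X) : ℝ := by
  classical exact ∑ x, if p x then s x else 0

/-- A point of the simplex is a probability measure on the vertices and `stdSimplex.map` is
push-forward, so masses are computed on preimages. -/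
theorem mass_map (f : X → Y) (p : Y → Prop) (s : stdSimplex ℝ X) :
    mass p (stdSimplex.map f s) = mass (fun x => p (f x)) s := by
  classical
  simp only [mass, stdSimplex.map_coe, FunOnFinite.linearMap_apply_apply]
  rw [← Finset.sum_fiberwise Finset.univ f]
  refine Finset.sum_congr rfl fun y _ => ?_
  split_ifs with h
  · exact Finset.sum_congr rfl fun x hx => by simp [(Finset.mem_filter.1 hx).2, h]
  · exact (Finset.sum_eq_zero fun x hx => by simp [(Finset.mem_filter.1 hx).2, h]).symm

theorem mass_mono {p q : X → Prop} (h : ∀ x, p x → q x) (s : stdSimplex ℝ X) :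
    mass p s ≤ mass q s := by
  classical
  refine Finset.sum_le_sum fun x _ => ?_
  have := s.2.1 x
  by_cases hp : p x
  · simp [hp, h x hp]
  · simp only [hp, if_false]
    split_ifs
    · exact this
    · exact le_rfl

theorem mass_false (s : stdSimplex ℝ X) : mass (fun _ => False) s = 0 := by
  simp [mass]

theorem mass_true (s : stdSimplex ℝ X) : mass (fun _ => True) s = 1 := by
  simp [mass]

theorem stdSimplexHomeomorphUnitInterval_eq_mass (s : stdSimplex ℝ (Fin 2)) :
    (stdSimplexHomeomorphUnitInterval s : ℝ) = mass (fun k => k = 1) s := by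
  simp [mass, stdSimplexHomeomorphUnitInterval, stdSimplexEquivIcc]
  rfl

/-- Each barycentric coordinate is the difference of two consecutive tail sums. Tail sums are the
convenient coordinates for prisms, because the walls between the prism simplices are their graphs.
-/
theorem eq_of_mass_eq {n : ℕ} {r r' : stdSimplex ℝ (Fin (n + 1))}
    (h : ∀ k, mass (fun m => k ≤ m) r = mass (fun m => k ≤ m) r') : r = r' := by
  classical
  have key : ∀ (s : stdSimplex ℝ (Fin (n + 1))) (k : Fin (n + 1)),
      s k = mass (fun m => k ≤ m) s - mass (fun m => k < m) s := by
    intro s k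
    simp only [mass, ← Finset.sum_sub_distrib]
    rw [Finset.sum_eq_single k]
    · simp
    · intro m _ hm
      rcases lt_or_gt_of_ne hm with h | h
      · simp [h.not_ge, h.not_gt]
      · simp [h, h.le]
    · simp
  ext k
  rw [key, key, h k]
  congr 1
  by_cases hk : k = Fin.last n
  · have : ∀ m : Fin (n + 1), ¬ k < m := fun m => by rw [hk]; exact (Fin.le_last m).not_gt
    simp [mass, this]
  · have hlt : k.val < n := Fin.lt_last_iff_ne_last.2 hk
    obtain ⟨l, hl⟩ : ∃ l : Fin (n + 1), l.val = k.val + 1 := ⟨⟨k.val + 1, by omega⟩, rfl⟩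
    have : ∀ m : Fin (n + 1), k < m ↔ l ≤ m := fun m => by
      rw [Fin.lt_def, Fin.le_def, hl, Nat.succ_le_iff]
    simp only [this, h]

end Mass

/-! ### The triangulation of Δ_n × I. -/

/-- The vertices of the `i`-th prism simplex which lie at the end `1`. -/
def prismEnd {n : ℕ} (i : Fin (n + 1)) : Fin (n + 2) →o Fin 2 where
  toFun k := if k ≤ i.castSucc then 0 else 1
  monotone' a b h := by
    by_cases hb : b ≤ i.castSucc
    · simp [hb, h.trans hb]
    · simp only [hb, if_false]
      exact Fin.le_last _

/-- The `i`-th simplex `Δ_{n+1} → Δ_n × I` of the prism. -/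
noncomputable def prism {n : ℕ} (i : Fin (n + 1)) :
    C(stdSimplex ℝ (Fin (n + 2)), stdSimplex ℝ (Fin (n + 1)) × I) where
  toFun r := (stdSimplex.map i.predAbove r,
    stdSimplexHomeomorphUnitInterval (stdSimplex.map (prismEnd i) r))
  continuous_toFun := (stdSimplex.continuous_map _).prodMk
    ((Homeomorph.continuous _).comp (stdSimplex.continuous_map _))

theorem prismEnd_apply {n : ℕ} (i : Fin (n + 1)) (k : Fin (n + 2)) :
    prismEnd i k = if k ≤ i.castSucc then 0 else 1 := rfl

theorem predAbove_val {n : ℕ} (i : Fin (n + 1)) (k : Fin (n + 2)) :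
    (i.predAbove k : ℕ) = if (k : ℕ) ≤ i then (k : ℕ) else k - 1 := by
  by_cases h : k ≤ i.castSucc
  · rw [Fin.predAbove_of_le_castSucc _ _ h, if_pos (by simpa [Fin.le_def] using h)]
    rfl
  · rw [Fin.predAbove_of_castSucc_lt _ _ (not_le.1 h), if_neg (by simpa [Fin.le_def] using h)]
    rfl

theorem succAbove_val {n : ℕ} (i : Fin (n + 2)) (k : Fin (n + 1)) :
    (i.succAbove k : ℕ) = if (k : ℕ) < i then (k : ℕ) else k + 1 := by
  simp only [Fin.succAbove, Fin.lt_def]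
  split_ifs <;> simp at * <;> omega

theorem prism_fst {n : ℕ} (i : Fin (n + 1)) (r : stdSimplex ℝ (Fin (n + 2)))
    (p : Fin (n + 1) → Prop) :
    mass p (prism i r).1 = mass (fun k => p (i.predAbove k)) r :=
  mass_map _ _ _

theorem prism_snd {n : ℕ} (i : Fin (n + 1)) (r : stdSimplex ℝ (Fin (n + 2))) :
    ((prism i r).2 : ℝ) = mass (fun k => i.castSucc < k) r := by
  refine (stdSimplexHomeomorphUnitInterval_eq_mass _).trans ((mass_map _ _ _).trans ?_)
  congr 1
  ext k
  by_cases h : k ≤ i.castSucc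
  · simp [prismEnd_apply, h, h.not_gt]
  · simp [prismEnd_apply, h, not_le.1 h]

/-- The map `i.predAbove` only collapses the vertices i and i + 1. Every tail except the one
starting at i + 1 is therefore a preimage of a tail of Δ_n; here the start is at most i, in the next
lemma it exceeds i + 1. -/
theorem le_predAbove_iff {n : ℕ} (i : Fin (n + 1)) (k m : Fin (n + 2)) (h : k ≤ i.castSucc) :
    k ≤ m ↔ i.predAbove k ≤ i.predAbove m := by
  rw [Fin.le_def, Fin.le_def, predAbove_val, predAbove_val]
  have : (k : ℕ) < n + 2 := k.2
  simp only [Fin.le_def, Fin.val_castSucc] at h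
  split_ifs <;> omega

theorem le_predAbove_iff' {n : ℕ} (i : Fin (n + 1)) (k m : Fin (n + 2)) (h : i.succ < k) :
    k ≤ m ↔ i.predAbove k ≤ i.predAbove m := by
  rw [Fin.le_def, Fin.le_def, predAbove_val, predAbove_val]
  have : (k : ℕ) < n + 2 := k.2
  simp only [Fin.lt_def, Fin.val_succ] at h
  split_ifs <;> omega

/-- All tail sums of r can be read off from its image: the one starting at i + 1 is the
I-coordinate, the others are tail sums of the Δ_n-coordinate. -/
theorem prism_injective {n : ℕ} (i : Fin (n + 1)) : Function.Injective (prism i) := by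
  intro r r' h
  refine eq_of_mass_eq fun k => ?_
  have h1 := prism_fst i r
  have h2 := prism_snd i r
  rw [h] at h1 h2
  by_cases hk : k ≤ i.castSucc
  · simp only [le_predAbove_iff i k _ hk]
    rw [← h1 (fun m => i.predAbove k ≤ m), prism_fst]
  by_cases hk' : i.succ < k
  · simp only [le_predAbove_iff' i k _ hk']
    rw [← h1 (fun m => i.predAbove k ≤ m), prism_fst]
  · have : ∀ m, k ≤ m ↔ i.castSucc < m := by
      intro m
      simp only [Fin.le_def, Fin.lt_def] at *
      simp at *
      omega
    simp only [this]
    rw [← h2, prism_snd]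

/-- The omitted vertex i + 1 is the one over i at the end 1. Without it no two vertices lie over the
same vertex of Δ_n, and the face is the graph of a tail sum: the lower wall of the i-th simplex. -/
theorem prism_face {n : ℕ} (i : Fin (n + 1)) (t : stdSimplex ℝ (Fin (n + 1))) :
    (prism i (stdSimplex.map i.succ.succAbove t)).1 = t ∧
    ((prism i (stdSimplex.map i.succ.succAbove t)).2 : ℝ) = mass (fun k => i < k) t := by
  constructor
  · change stdSimplex.map _ (stdSimplex.map _ t) = t
    rw [stdSimplex.map_comp_apply]
    convert stdSimplex.map_id_apply t
    ext k
    simp only [Function.comp_apply, predAbove_val, succAbove_val, Fin.val_succ, id]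
    split_ifs <;> omega
  · rw [prism_snd, mass_map]
    congr 1
    ext k
    simp only [Fin.lt_def, succAbove_val, Fin.val_castSucc, Fin.val_succ]
    split_ifs <;> omega

/-- The omitted vertex is now the one over i at the end 0, which leaves the upper wall. -/
theorem prism_face' {n : ℕ} (i : Fin (n + 1)) (t : stdSimplex ℝ (Fin (n + 1))) :
    (prism i (stdSimplex.map i.castSucc.succAbove t)).1 = t ∧
    ((prism i (stdSimplex.map i.castSucc.succAbove t)).2 : ℝ) = mass (fun k => i ≤ k) t := by
  constructor
  · change stdSimplex.map _ (stdSimplex.map _ t) = t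
    rw [stdSimplex.map_comp_apply]
    convert stdSimplex.map_id_apply t
    ext k
    simp only [Function.comp_apply, predAbove_val, succAbove_val, Fin.val_castSucc, id]
    split_ifs <;> omega
  · rw [prism_snd, mass_map]
    congr 1
    ext k
    simp only [Fin.lt_def, Fin.le_def, succAbove_val, Fin.val_castSucc]
    split_ifs <;> omega

/-- The graphs of the tail sums cut Δ_n × I into layers, and the i-th simplex lies in the layer
between the sums over `i < k` and `i ≤ k`. The layers descend as i grows. -/
theorem prism_mem {n : ℕ} (i : Fin (n + 1)) (r : stdSimplex ℝ (Fin (n + 2))) :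
    mass (fun k => i < k) (prism i r).1 ≤ (prism i r).2 ∧
    ((prism i r).2 : ℝ) ≤ mass (fun k => i ≤ k) (prism i r).1 := by
  rw [prism_fst, prism_fst, prism_snd]
  constructor <;> refine mass_mono (fun k hk => ?_) r
  · simp only [Fin.lt_def, predAbove_val, Fin.val_castSucc] at *
    split_ifs at hk <;> omega
  · simp only [Fin.lt_def, Fin.le_def, predAbove_val, Fin.val_castSucc] at *
    split_ifs <;> omega

/-- The points over t on the lower and the upper wall are known, and masses are affine; the convex
combination with the weights that express u between the two tail sums is a preimage. -/
theorem prism_surjective_of_mem {n : ℕ} (i : Fin (n + 1)) (t : stdSimplex ℝ (Fin (n + 1))) (u : I)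
    (h1 : mass (fun k => i < k) t ≤ u) (h2 : (u : ℝ) ≤ mass (fun k => i ≤ k) t) :
    ∃ r, prism i r = (t, u) := by
  classical
  obtain ⟨a, b, ha, hb, hab, hu⟩ : (u : ℝ) ∈
      segment ℝ (mass (fun k => i < k) t) (mass (fun k => i ≤ k) t) := by
    rw [segment_eq_Icc (h1.trans h2)]
    exact ⟨h1, h2⟩
  have hm : ∀ x y : stdSimplex ℝ (Fin (n + 2)), ∀ z : stdSimplex ℝ (Fin (n + 2)),
      (∀ k, z k = a * x k + b * y k) → ∀ p, mass p z = a * mass p x + b * mass p y := by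
    intro x y z hz p
    simp only [mass, Finset.mul_sum, ← Finset.sum_add_distrib, hz]
    exact Finset.sum_congr rfl fun k _ => by split_ifs <;> simp
  let z : stdSimplex ℝ (Fin (n + 2)) :=
    ⟨a • (stdSimplex.map i.succ.succAbove t).1 + b • (stdSimplex.map i.castSucc.succAbove t).1,
      convex_stdSimplex _ _ (Subtype.prop _) (Subtype.prop _) ha hb hab⟩
  have hz := hm _ _ z fun k => rfl
  refine ⟨z, Prod.ext (eq_of_mass_eq fun k => ?_) (Subtype.ext ?_)⟩
  · rw [prism_fst, hz, ← prism_fst, ← prism_fst, (prism_face i t).1, (prism_face' i t).1, ← add_mul,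
      hab, one_mul]
  · rw [prism_snd, hz, ← prism_snd, ← prism_snd, (prism_face i t).2, (prism_face' i t).2, ← hu]
    rfl

theorem prism_surjective {n : ℕ} (t : stdSimplex ℝ (Fin (n + 1))) (u : I) :
    ∃ i r, prism i r = (t, u) := by
  classical
  have h0 : (0 : Fin (n + 1)) ∈ Finset.univ.filter
      fun i : Fin (n + 1) => (u : ℝ) ≤ mass (fun k => i ≤ k) t := by
    simp only [Finset.mem_filter, Finset.mem_univ, true_and, Fin.zero_le, mass_true]
    exact u.2.2
  -- The layer containing (t, u) is given by the last i whose tail sum still dominates u; by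
  -- maximality the next tail sum is smaller than u.
  obtain ⟨i, hi⟩ := Finset.exists_maximal ⟨_, h0⟩
  refine ⟨i, prism_surjective_of_mem i t u ?_ (Finset.mem_filter.1 hi.1).2⟩
  by_cases hk : i = Fin.last n
  · have : ∀ m : Fin (n + 1), ¬ i < m := fun m => by rw [hk]; exact (Fin.le_last m).not_gt
    simp only [this, mass_false]
    exact u.2.1
  · have hlt : i.val < n := Fin.lt_last_iff_ne_last.2 hk
    obtain ⟨l, hl⟩ : ∃ l : Fin (n + 1), l.val = i.val + 1 := ⟨⟨i.val + 1, by omega⟩, rfl⟩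
    have e : ∀ m : Fin (n + 1), i < m ↔ l ≤ m := fun m => by
      rw [Fin.lt_def, Fin.le_def, hl, Nat.succ_le_iff]
    simp only [e]
    by_contra! h
    have := hi.2 (y := l) (by simpa using h.le)
    have h3 : i < l := (e l).2 le_rfl
    exact absurd (this h3.le) h3.not_ge

/-! ### Gluing the prisms to a map |X| × I → |X × I|. -/

variable {X : Type} [TopologicalSpace X]

/-- Two prism simplices meet only in common faces, and |X| identifies faces. Induction on the
distance of the layers: a point common to layers i < j lies on the lower wall of layer i, which is
the upper wall of layer i + 1. -/
theorem mk_prism_eq {n : ℕ} (s : C(stdSimplex ℝ (Fin (n + 1)) × I, X)) {i j : Fin (n + 1)}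
    {r r' : stdSimplex ℝ (Fin (n + 2))} (h : prism i r = prism j r') :
    Realization.mk (s.comp (prism i)) r = Realization.mk (s.comp (prism j)) r' := by
  have key : ∀ (d : ℕ) (i j : Fin (n + 1)), i.val + d = j.val →
      ∀ r r' : stdSimplex ℝ (Fin (n + 2)), prism i r = prism j r' →
      Realization.mk (s.comp (prism i)) r = Realization.mk (s.comp (prism j)) r' := by
    intro d
    induction d with
    | zero =>
      intro i j hd r r' h
      obtain rfl : i = j := Fin.ext (by omega)
      rw [prism_injective i h]
    | succ d ih =>
      intro i j hd r r' h
      set t := (prism i r).1 with ht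
      obtain ⟨l, hl⟩ : ∃ l : Fin (n + 1), l.val = i.val + 1 := ⟨⟨i.val + 1, by omega⟩, rfl⟩
      have hc : l.castSucc = i.succ := Fin.ext (by simp [hl])
      -- The point also lies in the layer j > i, so its height is at most the sum over `j ≤ k`,
      -- hence at most the sum over `i < k`. This forces it onto the lower wall.
      have hu : ((prism i r).2 : ℝ) = mass (fun k => i < k) t := by
        refine le_antisymm ?_ (prism_mem i r).1
        rw [ht, h]
        refine (prism_mem j r').2.trans (mass_mono (fun k hk => ?_) _)
        simp only [Fin.le_def, Fin.lt_def] at *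
        omega
      have h1 : prism i (stdSimplex.map i.succ.succAbove t) = prism i r :=
        Prod.ext (prism_face i t).1 (Subtype.ext ((prism_face i t).2.trans hu.symm))
      have h2 : ∀ t, prism l (stdSimplex.map i.succ.succAbove t) =
          prism i (stdSimplex.map i.succ.succAbove t) := by
        intro t
        refine Prod.ext ?_ (Subtype.ext ?_)
        · rw [(prism_face i t).1, ← hc, (prism_face' l t).1]
        · rw [(prism_face i t).2, ← hc, (prism_face' l t).2]
          congr 1
          ext k
          simp only [Fin.le_def, Fin.lt_def]
          omega
      rw [← ih l j (by omega) (stdSimplex.map i.succ.succAbove t) r'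
        ((h2 t).trans (h1.trans h)), ← prism_injective i h1]
      have e := Realization.mk_map (s.comp (prism i)) i.succ.succAboveOrderEmb.toOrderHom t
      have e' := Realization.mk_map (s.comp (prism l)) i.succ.succAboveOrderEmb.toOrderHom t
      refine e.trans (Eq.trans ?_ e'.symm)
      congr 1
      exact ContinuousMap.ext fun t => congrArg s (h2 t).symm
  rcases le_total i j with hij | hij
  · exact key (j.val - i.val) i j (by simp only [Fin.le_def] at hij; omega) r r' h
  · exact (key (i.val - j.val) j i (by simp only [Fin.le_def] at hij; omega) r' r h.symm).symm

/-- The quotient map from the disjoint union of the prism simplices to `Δ_n × I`. -/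
noncomputable def prismCover (n : ℕ) :
    C((_ : Fin (n + 1)) × stdSimplex ℝ (Fin (n + 2)), stdSimplex ℝ (Fin (n + 1)) × I) where
  toFun z := prism z.1 z.2
  continuous_toFun := continuous_sigma fun i => (prism i).continuous

/-- A continuous surjection from a compact space to a Hausdorff space is closed. -/
theorem isQuotientMap_prismCover (n : ℕ) : IsQuotientMap (prismCover n) :=
  (prismCover n).continuous.isClosedMap.isQuotientMap (prismCover n).continuous fun z => by
    obtain ⟨i, r, h⟩ := prism_surjective z.1 z.2
    exact ⟨⟨i, r⟩, h⟩

/-- The maps `Δ_{n+1} → |X|` which are given by the prism simplices. -/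
noncomputable def Realization.prismMkAux {n : ℕ} (s : C(stdSimplex ℝ (Fin (n + 1)) × I, X)) :
    C((_ : Fin (n + 1)) × stdSimplex ℝ (Fin (n + 2)), Realization X) where
  toFun z := Realization.mk (n := n + 1) (s.comp (prism z.1)) z.2
  continuous_toFun := continuous_sigma fun i => Realization.continuous_mk (n := n + 1) (s.comp (prism i))

theorem Realization.prismMkAux_eq {n : ℕ} (s : C(stdSimplex ℝ (Fin (n + 1)) × I, X))
    (z w : (_ : Fin (n + 1)) × stdSimplex ℝ (Fin (n + 2))) (h : prismCover n z = prismCover n w) :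
    Realization.prismMkAux s z = Realization.prismMkAux s w :=
  mk_prism_eq s (i := z.1) (j := w.1) (r := z.2) (r' := w.2) h

/-- The map `Δ_n × I → |X|` given by the triangulated prism in `X`. -/
noncomputable def Realization.prismMk {n : ℕ} (s : C(stdSimplex ℝ (Fin (n + 1)) × I, X)) :
    C(stdSimplex ℝ (Fin (n + 1)) × I, Realization X) :=
  (isQuotientMap_prismCover n).lift (Realization.prismMkAux s) (Realization.prismMkAux_eq s)

theorem Realization.prismMk_prismCover {n : ℕ} (s : C(stdSimplex ℝ (Fin (n + 1)) × I, X))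
    (z : (_ : Fin (n + 1)) × stdSimplex ℝ (Fin (n + 2))) :
    Realization.prismMk s (prismCover n z) = Realization.prismMkAux s z :=
  DFunLike.congr_fun ((isQuotientMap_prismCover n).lift_comp
    (Realization.prismMkAux s) (Realization.prismMkAux_eq s)) z

theorem Realization.prismMk_prism {n : ℕ} (s : C(stdSimplex ℝ (Fin (n + 1)) × I, X))
    (i : Fin (n + 1)) (r : stdSimplex ℝ (Fin (n + 2))) :
    Realization.prismMk s (prism i r) = Realization.mk (n := n + 1) (s.comp (prism i)) r :=
  Realization.prismMk_prismCover s ⟨i, r⟩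

/-- The map of vertices of prisms which covers `α : [m] → [n]`. -/
def prismVertexMap {m n : ℕ} (α : Fin (m + 1) →o Fin (n + 1)) (i : Fin (m + 1)) :
    Fin (m + 2) →o Fin (n + 2) where
  toFun k := if k ≤ i.castSucc then (α (i.predAbove k)).castSucc else (α (i.predAbove k)).succ
  monotone' a b h := by
    have h1 := α.monotone ((Fin.predAbove_right_monotone i) h)
    simp only [Fin.le_def] at *
    split_ifs <;> simp at * <;> omega

theorem prismVertexMap_apply {m n : ℕ} (α : Fin (m + 1) →o Fin (n + 1)) (i : Fin (m + 1))
    (k : Fin (m + 2)) : prismVertexMap α i k =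
      if k ≤ i.castSucc then (α (i.predAbove k)).castSucc else (α (i.predAbove k)).succ := rfl

/-- By monotonicity of α, vertices up to i go to vertices up to α i and vertices from i on to
vertices from α i on. So α × id carries the i-th prism simplex linearly into the (α i)-th one. -/
theorem prism_vertexMap {m n : ℕ} (α : Fin (m + 1) →o Fin (n + 1)) (i : Fin (m + 1))
    (r : stdSimplex ℝ (Fin (m + 2))) :
    prism (α i) (stdSimplex.map (prismVertexMap α i) r) =
      (stdSimplex.map α (prism i r).1, (prism i r).2) := by
  have key : ∀ k, k ≤ i.castSucc → α (i.predAbove k) ≤ α i := fun k hk =>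
    α.monotone ((Fin.predAbove_right_monotone i hk).trans (by simp))
  have key' : ∀ k, ¬ k ≤ i.castSucc → α i ≤ α (i.predAbove k) := fun k hk => by
    refine α.monotone (le_trans ?_ (Fin.predAbove_right_monotone i
      (show i.succ ≤ k by simp only [Fin.le_def] at *; simp at *; omega)))
    simp
  refine Prod.ext ?_ (Subtype.ext ?_)
  · change stdSimplex.map _ (stdSimplex.map _ r) = stdSimplex.map _ (stdSimplex.map _ r)
    rw [stdSimplex.map_comp_apply, stdSimplex.map_comp_apply]
    congr 1
    ext k
    simp only [Function.comp_apply, prismVertexMap_apply]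
    split_ifs with h
    · simp [Fin.predAbove_of_le_castSucc _ _ (Fin.castSucc_le_castSucc_iff.2 (key k h))]
    · simp [Fin.predAbove_of_castSucc_lt _ _ (Fin.castSucc_lt_succ_iff.2 (key' k h))]
  · rw [prism_snd, mass_map]
    change _ = ((prism i r).2 : ℝ)
    rw [prism_snd]
    congr 1
    ext k
    simp only [prismVertexMap_apply]
    split_ifs with h
    · have := key k h
      simp only [Fin.lt_def, Fin.le_def] at *
      simp at *
      omega
    · have := key' k h
      simp only [Fin.lt_def, Fin.le_def] at *
      simp at *
      omega

/-- Naturality of the prism maps in the simplicial operators, which makes `cylinderAux` a map of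
simplicial sets. -/
theorem Realization.prismMk_map {m n : ℕ} (s : C(stdSimplex ℝ (Fin (n + 1)) × I, X))
    (α : Fin (m + 1) →o Fin (n + 1)) (t : stdSimplex ℝ (Fin (m + 1))) (u : I) :
    Realization.prismMk s (stdSimplex.map α t, u) =
      Realization.prismMk (s.comp (.prodMap ⟨stdSimplex.map α, stdSimplex.continuous_map α⟩
        (.id I))) (t, u) := by
  obtain ⟨i, r, h⟩ := prism_surjective t u
  have h' := prism_vertexMap α i r
  rw [h] at h'
  rw [← h, ← h', prismMk_prism, prismMk_prism, Realization.mk_map]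
  congr 1
  exact ContinuousMap.ext fun r => congrArg s (prism_vertexMap α i r)

/-- The unit of the adjunction sends a singular simplex s to `Realization.mk s`, so the transpose of
f sends s to f ∘ `mk s`. -/
theorem Realization.homEquiv_mk {Z : TopCat.{0}} (f : SSet.toTop.obj (TopCat.toSSet.obj (TopCat.of X)) ⟶ Z)
    {n : ℕ} (s : C(stdSimplex ℝ (Fin (n + 1)), X)) (t : stdSimplex ℝ (Fin (n + 1))) :
    TopCat.toSSetObjEquiv Z (Opposite.op (SimplexCategory.mk n))
      ((sSetTopAdj.homEquiv _ _ f).app (Opposite.op (SimplexCategory.mk n))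
        ((TopCat.toSSetObjEquiv (TopCat.of X) (Opposite.op (SimplexCategory.mk n))).symm s)) t =
      f (Realization.mk s t) := by
  rw [Adjunction.homEquiv_unit]
  have h := sSetTopAdj_unit_app_app_down (TopCat.toSSet.obj (TopCat.of X))
    (Opposite.op (SimplexCategory.mk n))
    ((TopCat.toSSetObjEquiv (TopCat.of X) (Opposite.op (SimplexCategory.mk n))).symm s)
  exact congrArg (fun g : SimplexCategory.toTop.obj (SimplexCategory.mk n) ⟶ _ =>
    f (g (ULift.up t))) h

/-- Maps out of |X| are determined on the points `mk s t`. Give `Prop` the indiscrete topology, so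
that every predicate is continuous; "being of the form `mk s t`" and "true" agree on these points
and hence everywhere. -/
theorem Realization.exists_mk (x : Realization X) :
    ∃ (n : ℕ) (s : C(stdSimplex ℝ (Fin (n + 1)), X)) (t : stdSimplex ℝ (Fin (n + 1))),
      Realization.mk s t = x := by
  let τ : TopologicalSpace Prop := ⊤
  let Z : TopCat.{0} := @TopCat.of Prop τ
  let f : SSet.toTop.obj (TopCat.toSSet.obj (TopCat.of X)) ⟶ Z :=
    @TopCat.ofHom _ _ _ τ (@ContinuousMap.mk _ _ _ τ (fun x => ∃ (n : ℕ)
      (s : C(stdSimplex ℝ (Fin (n + 1)), X)) (t : stdSimplex ℝ (Fin (n + 1))),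
      Realization.mk s t = x) continuous_top)
  let g : SSet.toTop.obj (TopCat.toSSet.obj (TopCat.of X)) ⟶ Z :=
    @TopCat.ofHom _ _ _ τ (@ContinuousMap.mk _ _ _ τ (fun _ => True) continuous_top)
  have h : f = g := by
    apply (sSetTopAdj.homEquiv _ _).injective
    ext ⟨n⟩ s
    induction n using SimplexCategory.rec with | _ n
    obtain ⟨s, rfl⟩ := (TopCat.toSSetObjEquiv (TopCat.of X) _).symm.surjective s
    apply (TopCat.toSSetObjEquiv Z _).injective
    ext t
    refine (iff_of_eq (Realization.homEquiv_mk f s t)).trans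
      (Iff.trans ?_ (iff_of_eq (Realization.homEquiv_mk g s t)).symm)
    exact iff_of_true ⟨n, s, t, rfl⟩ trivial
  have h2 : (f x : Prop) = (g x : Prop) := by rw [h]
  exact h2.mpr trivial

/-- The map `|X| → |X × I|^I` as a map of simplicial sets. -/
noncomputable def Realization.cylinderAux (X : Type) [TopologicalSpace X] :
    TopCat.toSSet.obj (TopCat.of X) ⟶ TopCat.toSSet.obj (TopCat.of C(I, Realization (X × I))) where
  app n := TypeCat.ofHom fun s => (TopCat.toSSetObjEquiv (TopCat.of C(I, Realization (X × I))) n).symm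
    (Realization.prismMk ((TopCat.toSSetObjEquiv (TopCat.of X) n s).prodMap (.id I))).curry
  naturality {m n} α := by
    ext s
    apply (TopCat.toSSetObjEquiv _ _).injective
    ext t u
    exact (Realization.prismMk_map ((TopCat.toSSetObjEquiv (TopCat.of X) m s).prodMap (.id I)) α.unop.toOrderHom t u).symm

/-- The map `|X| × I → |X × I|`, `(x, u) ↦ ω_L (x, ι u)`. -/
noncomputable def Realization.cylinder (X : Type) [TopologicalSpace X] :
    C(Realization X × I, Realization (X × I)) :=
  -- The adjunction only yields maps out of |X|, so the cylinder is first built with values in C(I,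
  -- |X × I|). Uncurrying is continuous because I is locally compact, and the ordinary product
  -- topology on |X| × I suffices.
  ContinuousMap.uncurry
    ((sSetTopAdj.homEquiv _ _).symm (Realization.cylinderAux X)).hom

theorem Realization.cylinder_mk {n : ℕ} (s : C(stdSimplex ℝ (Fin (n + 1)), X))
    (i : Fin (n + 1)) (r : stdSimplex ℝ (Fin (n + 2))) :
    Realization.cylinder X (Realization.mk s (prism i r).1, (prism i r).2) =
      Realization.mk ((s.prodMap (.id I)).comp (prism i)) r := by
  have h := Realization.homEquiv_mk ((sSetTopAdj.homEquiv _ _).symm (Realization.cylinderAux X)) s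
    (prism i r).1
  rw [Equiv.apply_symm_apply] at h
  refine (congrArg (fun f : C(I, Realization (X × I)) => f (prism i r).2) h).symm.trans ?_
  exact Realization.prismMk_prism (s.prodMap (.id I)) i r

/-- Every point of |X| × I lies on a prism simplex over some singular simplex, where `cylinder_mk`
gives the value of the cylinder map. -/
theorem Realization.cylinder_induction {p : Realization X × I → Prop}
    (h : ∀ {n : ℕ} (s : C(stdSimplex ℝ (Fin (n + 1)), X)) (i : Fin (n + 1))
      (r : stdSimplex ℝ (Fin (n + 2))), p (Realization.mk s (prism i r).1, (prism i r).2))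
    (z : Realization X × I) : p z := by
  obtain ⟨x, u⟩ := z
  obtain ⟨n, s, t, rfl⟩ := Realization.exists_mk x
  obtain ⟨i, r, hr⟩ := prism_surjective t u
  have := h s i r
  rwa [hr] at this

theorem Realization.map_fst_cylinder (z : Realization X × I) :
    Realization.map ⟨Prod.fst, continuous_fst⟩ (Realization.cylinder X z) = z.1 := by
  induction z using Realization.cylinder_induction with | _ s i r
  rw [cylinder_mk, map_mk]
  exact (Realization.mk_map s ⟨i.predAbove, Fin.predAbove_right_monotone i⟩ r).symm

theorem Realization.map_snd_cylinder (z : Realization X × I) :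
    Realization.map ⟨Prod.snd, continuous_snd⟩ (Realization.cylinder X z) = iota z.2 := by
  induction z using Realization.cylinder_induction with | _ s i r
  rw [cylinder_mk, map_mk]
  refine (Realization.mk_map (X := I) (stdSimplexHomeomorphUnitInterval : C(stdSimplex ℝ (Fin 2), I))
    (prismEnd i) r).symm.trans ?_
  rw [iota]
  congr 1
  exact (Homeomorph.symm_apply_apply _ _).symm

theorem Realization.cylinder_map {Y : Type} [TopologicalSpace Y] (f : C(X, Y))
    (z : Realization X × I) :
    Realization.cylinder Y (Realization.map f z.1, z.2) =
      Realization.map (f.prodMap (.id I)) (Realization.cylinder X z) := by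
  induction z using Realization.cylinder_induction with | _ s i r
  simp only [cylinder_mk, map_mk]
  rfl

/-- The bottom Δ_n × 0 is the lower wall of the last prism simplex, because the tail sum beyond the
last vertex vanishes. -/
theorem Realization.cylinder_zero (x : Realization X) :
    Realization.cylinder X (x, 0) = Realization.map ⟨fun x => (x, 0), by fun_prop⟩ x := by
  obtain ⟨n, s, t, rfl⟩ := Realization.exists_mk x
  have h0 : ∀ t : stdSimplex ℝ (Fin (n + 1)), prism (Fin.last n)
      (stdSimplex.map (Fin.last n).succ.succAbove t) = (t, 0) := fun t =>
    Prod.ext (prism_face _ t).1 (Subtype.ext ((prism_face _ t).2.trans (by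
      simp only [(Fin.le_last _).not_gt, mass_false]
      rfl)))
  have h := Realization.cylinder_mk s (Fin.last n)
    (stdSimplex.map (Fin.last n).succ.succAboveOrderEmb.toOrderHom t)
  rw [Realization.mk_map] at h
  have e := h0 t
  change prism (Fin.last n) (stdSimplex.map (Fin.last n).succ.succAboveOrderEmb.toOrderHom t) = _ at e
  rw [e] at h
  rw [h, map_mk]
  congr 1
  exact ContinuousMap.ext fun t => congrArg (s.prodMap (.id I)) (h0 t)

/-- The top Δ_n × 1 is the upper wall of the prism simplex 0, because the full sum is 1. -/
theorem Realization.cylinder_one (x : Realization X) :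
    Realization.cylinder X (x, 1) = Realization.map ⟨fun x => (x, 1), by fun_prop⟩ x := by
  obtain ⟨n, s, t, rfl⟩ := Realization.exists_mk x
  have h0 : ∀ t : stdSimplex ℝ (Fin (n + 1)), prism 0
      (stdSimplex.map (Fin.castSucc 0).succAbove t) = (t, 1) := fun t =>
    Prod.ext (prism_face' _ t).1 (Subtype.ext ((prism_face' _ t).2.trans (by
      simp only [Fin.zero_le, mass_true]
      rfl)))
  have h := Realization.cylinder_mk s 0
    (stdSimplex.map (Fin.castSucc (0 : Fin (n + 1))).succAboveOrderEmb.toOrderHom t)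
  rw [Realization.mk_map] at h
  have e := h0 t
  change prism 0 (stdSimplex.map (Fin.castSucc (0 : Fin (n + 1))).succAboveOrderEmb.toOrderHom t) = _ at e
  rw [e] at h
  rw [h, map_mk]
  congr 1
  exact ContinuousMap.ext fun t => congrArg (s.prodMap (.id I)) (h0 t)

/-! ### Homotopies of paths -/

namespace MapPath

variable {K : SpacePair} {Z : PointedSpace} {f g h k : K → Z}

namespace Homotopic

theorem symm {α β : MapPath f g} : α.Homotopic β → β.Homotopic α := by
  rintro ⟨Γ, h1, h2, h3, h4, h5, h6⟩
  refine ⟨fun x t s => Γ x t (σ s), h1.comp (f := fun z : K × I × I => (z.1, z.2.1, σ z.2.2))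
    (by fun_prop : Continuous _).kContinuous, fun x t s => h2 x t _, fun x t => ?_, fun x t => ?_,
    fun x s => h5 x _, fun x s => h6 x _⟩
  · simp [h4]
  · simp [h3]

theorem trans {α β γ : MapPath f g} : α.Homotopic β → β.Homotopic γ → α.Homotopic γ := by
  rintro ⟨Γ, h1, h2, h3, h4, h5, h6⟩ ⟨Γ', h1', h2', h3', h4', h5', h6'⟩
  -- A homotopy of paths is a path in its parameter s over the larger source K × I. Composing
  -- homotopies is then composing such paths.
  let K' : SpacePair := ⟨K × I, {z | z.1 ∈ K.sub}⟩
  let a : MapPath (K := K') (Z := Z) (fun z => α.map z.1 z.2) (fun z => β.map z.1 z.2) :=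
    { map := fun z s => Γ z.1 z.2 s
      kcont := h1.comp (f := fun z : (K × I) × I => (z.1.1, z.1.2, z.2))
        (by fun_prop : Continuous _).kContinuous
      map_sub := fun z s hz => h2 _ _ _ hz
      source := fun z => h3 _ _
      target := fun z => h4 _ _ }
  let b : MapPath (K := K') (Z := Z) (fun z => β.map z.1 z.2) (fun z => γ.map z.1 z.2) :=
    { map := fun z s => Γ' z.1 z.2 s
      kcont := h1'.comp (f := fun z : (K × I) × I => (z.1.1, z.1.2, z.2))
        (by fun_prop : Continuous _).kContinuous
      map_sub := fun z s hz => h2' _ _ _ hz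
      source := fun z => h3' _ _
      target := fun z => h4' _ _ }
  refine ⟨fun x t s => (a.trans b).map (x, t) s,
    (a.trans b).kcont.comp (f := fun z : K × I × I => (((z.1, z.2.1), z.2.2) : (K × I) × I))
    (by fun_prop : Continuous _).kContinuous, fun x t s hx => (a.trans b).map_sub (x, t) s hx,
    fun x t => (a.trans b).source (x, t), fun x t => (a.trans b).target (x, t), fun x s => ?_,
    fun x s => ?_⟩
  · simp only [MapPath.trans, a, b, h5, h5', ite_self]
  · simp only [MapPath.trans, a, b, h6, h6', ite_self]

end Homotopic

/-- Two paths which factor through maps `p, q : I → C`, with the same end points, into a convex set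
`C` are homotopic. -/
theorem homotopic_of_convex {V : Type} [AddCommGroup V] [Module ℝ V] [TopologicalSpace V]
    [IsTopologicalAddGroup V] [ContinuousSMul ℝ V] {C : Set V} (hC : Convex ℝ C)
    {S : K → C → Z} (hS : KContinuous (fun z : K × C => S z.1 z.2))
    (hpt : ∀ x v, x ∈ K.sub → S x v = Z.pt) (p q : C(I, C)) (h0 : p 0 = q 0) (h1 : p 1 = q 1)
    {α β : MapPath f g} (hα : ∀ x t, α.map x t = S x (p t)) (hβ : ∀ x t, β.map x t = S x (q t)) :
    α.Homotopic β := by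
  have e : ∀ (v : C) (s : I), ((1 - s : ℝ) • (v : V) + (s : ℝ) • (v : V)) = v := fun v s => by
    rw [← add_smul, sub_add_cancel, one_smul]
  let H : I → I → C := fun t s => ⟨(1 - s : ℝ) • (p t : V) + (s : ℝ) • (q t : V),
    hC (p t).2 (q t).2 (sub_nonneg.2 s.2.2) s.2.1 (by ring)⟩
  have hH : Continuous fun z : I × I => H z.1 z.2 := by
    refine Continuous.subtype_mk ?_ _
    fun_prop
  refine ⟨fun x t s => S x (H t s), hS.comp (f := fun z : K × I × I => (z.1, H z.2.1 z.2.2))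
    (by fun_prop : Continuous _).kContinuous, fun x t s hx => hpt _ _ hx, fun x t => ?_,
    fun x t => ?_, fun x s => ?_, fun x s => ?_⟩
  · rw [hα]
    simp [H]
  · rw [hβ]
    simp [H]
  · rw [← α.source, hα]
    refine congrArg (S x) (Subtype.ext ?_)
    change (1 - s : ℝ) • (p 0 : V) + (s : ℝ) • (q 0 : V) = p 0
    rw [← h0]
    exact e _ _
  · rw [← α.target, hα]
    refine congrArg (S x) (Subtype.ext ?_)
    change (1 - s : ℝ) • (p 1 : V) + (s : ℝ) • (q 1 : V) = p 1
    rw [← h1]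
    exact e _ _

theorem Homotopic.refl (α : MapPath f g) : α.Homotopic α :=
  ⟨fun x t _ => α.map x t, α.kcont.comp (f := fun z : K × I × I => (z.1, z.2.1))
    (by fun_prop : Continuous _).kContinuous, fun x t _ hx => α.map_sub x t hx, fun _ _ => rfl,
    fun _ _ => rfl, fun x _ => α.source x, fun x _ => α.target x⟩

theorem Homotopic.trans_congr {α α' : MapPath f g} {β β' : MapPath g h} :
    α.Homotopic α' → β.Homotopic β' → (α.trans β).Homotopic (α'.trans β') := by
  rintro ⟨Γ, h1, h2, h3, h4, h5, h6⟩ ⟨Γ', h1', h2', h3', h4', h5', h6'⟩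
  -- Here the homotopy parameter s joins the source and t remains the path variable, so that
  -- `MapPath.trans` concatenates the homotopies for every s at once.
  let K' : SpacePair := ⟨K × I, {z | z.1 ∈ K.sub}⟩
  let a : MapPath (K := K') (Z := Z) (fun z => f z.1) (fun z => g z.1) :=
    { map := fun z t => Γ z.1 t z.2
      kcont := h1.comp (f := fun z : (K × I) × I => (z.1.1, z.2, z.1.2))
        (by fun_prop : Continuous _).kContinuous
      map_sub := fun z s hz => h2 _ _ _ hz
      source := fun z => h5 _ _
      target := fun z => h6 _ _ }
  let b : MapPath (K := K') (Z := Z) (fun z => g z.1) (fun z => h z.1) :=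
    { map := fun z t => Γ' z.1 t z.2
      kcont := h1'.comp (f := fun z : (K × I) × I => (z.1.1, z.2, z.1.2))
        (by fun_prop : Continuous _).kContinuous
      map_sub := fun z s hz => h2' _ _ _ hz
      source := fun z => h5' _ _
      target := fun z => h6' _ _ }
  refine ⟨fun x t s => (a.trans b).map (x, s) t,
    (a.trans b).kcont.comp (f := fun z : K × I × I => (((z.1, z.2.2), z.2.1) : (K × I) × I))
    (by fun_prop : Continuous _).kContinuous, fun x t s hx => (a.trans b).map_sub (x, s) t hx,
    fun x t => ?_, fun x t => ?_, fun x s => (a.trans b).source (x, s),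
    fun x s => (a.trans b).target (x, s)⟩
  · simp only [MapPath.trans, a, b, h3, h3']
  · simp only [MapPath.trans, a, b, h4, h4']

/-- The concatenation of maps `I → C`. -/
noncomputable def concat {C : Type} [TopologicalSpace C] (p q : C(I, C)) (h : p 1 = q 0) :
    C(I, C) where
  toFun t := if (t : ℝ) ≤ 1 / 2 then p (projIcc 0 1 zero_le_one (2 * t))
    else q (projIcc 0 1 zero_le_one (2 * t - 1))
  continuous_toFun := by
    refine Continuous.if_le (by fun_prop) (by fun_prop) (by fun_prop) (by fun_prop) fun t ht => ?_
    have h1 : (2 * t : ℝ) = 1 := by linarith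
    have h2 : (2 * t - 1 : ℝ) = 0 := by linarith
    rw [h2, h1, projIcc_right, projIcc_left]
    exact h

theorem concat_zero {C : Type} [TopologicalSpace C] (p q : C(I, C)) (h : p 1 = q 0) :
    concat p q h 0 = p 0 := by
  simp [concat, projIcc_left]

theorem concat_one {C : Type} [TopologicalSpace C] (p q : C(I, C)) (h : p 1 = q 0) :
    concat p q h 1 = q 1 := by
  have : (2 * (1 : I) - 1 : ℝ) = 1 := by norm_num
  simp only [concat, ContinuousMap.coe_mk, this, projIcc_right]
  rw [if_neg (by norm_num)]
  rfl

/-- This reduces identities between composite paths to paths in a parameter space: if the pieces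
factor through one family S, so does the composite, and `homotopic_of_convex` applies. -/
theorem trans_map_eq {C : Type} [TopologicalSpace C] {S : K → C → Z} {p q : C(I, C)}
    (hpq : p 1 = q 0) {α : MapPath f g} {β : MapPath g h} (hα : ∀ x t, α.map x t = S x (p t))
    (hβ : ∀ x t, β.map x t = S x (q t)) (x : K) (t : I) :
    (α.trans β).map x t = S x (concat p q hpq t) := by
  simp only [MapPath.trans, concat, hα, hβ, ContinuousMap.coe_mk, apply_ite (S x)]

/-- A square `I × I → Map(K, Z)` is a homotopy between the two composites of its edges. -/
theorem homotopic_of_square {S : K → I → I → Z} (hS : KContinuous (fun z : K × I × I => S z.1 z.2.1 z.2.2))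
    (hpt : ∀ x s t, x ∈ K.sub → S x s t = Z.pt) {α : MapPath f g} {β : MapPath g k}
    {γ : MapPath f h} {δ : MapPath h k} (hα : ∀ x t, α.map x t = S x t 0)
    (hβ : ∀ x t, β.map x t = S x 1 t) (hγ : ∀ x t, γ.map x t = S x 0 t)
    (hδ : ∀ x t, δ.map x t = S x t 1) : (α.trans β).Homotopic (γ.trans δ) := by
  let C : Set (ℝ × ℝ) := Icc 0 1 ×ˢ Icc 0 1
  have hC : Convex ℝ C := (convex_Icc 0 1).prod (convex_Icc 0 1)
  let S' : K → C → Z := fun x v => S x ⟨v.1.1, v.2.1⟩ ⟨v.1.2, v.2.2⟩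
  have hS' : KContinuous fun z : K × C => S' z.1 z.2 :=
    hS.comp (f := fun z : K × C => ((z.1, ⟨z.2.1.1, z.2.2.1⟩, ⟨z.2.1.2, z.2.2.2⟩) : K × I × I))
      (by fun_prop : Continuous _).kContinuous
  let a : C(I, C) := ⟨fun t => ⟨(t, 0), t.2, by simp⟩, by fun_prop⟩
  let b : C(I, C) := ⟨fun t => ⟨(1, t), by simp, t.2⟩, by fun_prop⟩
  let c : C(I, C) := ⟨fun t => ⟨(0, t), by simp, t.2⟩, by fun_prop⟩
  let d : C(I, C) := ⟨fun t => ⟨(t, 1), t.2, by simp⟩, by fun_prop⟩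
  have hab : a 1 = b 0 := Subtype.ext (by simp [a, b])
  have hcd : c 1 = d 0 := Subtype.ext (by simp [c, d])
  refine homotopic_of_convex hC hS' (fun x v hx => hpt _ _ _ hx) (concat a b hab) (concat c d hcd)
    ?_ ?_ (trans_map_eq hab (fun x t => hα x t) (fun x t => hβ x t))
    (trans_map_eq hcd (fun x t => hγ x t) (fun x t => hδ x t))
  · rw [concat_zero, concat_zero]
    exact Subtype.ext (by simp [a, c])
  · rw [concat_one, concat_one]
    exact Subtype.ext (by simp [b, d])

/-- A triangle `Δ₂ → Map(K, Z)` is a homotopy between the long edge and the composite of the short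
edges. -/
theorem homotopic_of_triangle {S : K → stdSimplex ℝ (Fin 3) → Z}
    (hS : KContinuous (fun z : K × stdSimplex ℝ (Fin 3) => S z.1 z.2))
    (hpt : ∀ x t, x ∈ K.sub → S x t = Z.pt) {α : MapPath f g} {β : MapPath g h}
    {γ : MapPath f h}
    (hα : ∀ x t, α.map x t = S x (stdSimplex.map ![0, 1] (stdSimplexHomeomorphUnitInterval.symm t)))
    (hβ : ∀ x t, β.map x t = S x (stdSimplex.map ![1, 2] (stdSimplexHomeomorphUnitInterval.symm t)))
    (hγ : ∀ x t, γ.map x t =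
      S x (stdSimplex.map ![0, 2] (stdSimplexHomeomorphUnitInterval.symm t))) :
    (α.trans β).Homotopic γ := by
  have v0 : stdSimplexHomeomorphUnitInterval.symm 0 = stdSimplex.vertex (S := ℝ) (0 : Fin 2) :=
    (Homeomorph.symm_apply_eq _).2 rfl
  have v1 : stdSimplexHomeomorphUnitInterval.symm 1 = stdSimplex.vertex (S := ℝ) (1 : Fin 2) :=
    (Homeomorph.symm_apply_eq _).2 rfl
  let p : (Fin 2 → Fin 3) → C(I, stdSimplex ℝ (Fin 3)) := fun φ =>
    ⟨fun t => stdSimplex.map φ (stdSimplexHomeomorphUnitInterval.symm t),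
      (stdSimplex.continuous_map φ).comp (Homeomorph.continuous _)⟩
  have p0 : ∀ φ, p φ 0 = stdSimplex.vertex (φ 0) := fun φ =>
    (congrArg (stdSimplex.map φ) v0).trans (stdSimplex.map_vertex _ _)
  have p1 : ∀ φ, p φ 1 = stdSimplex.vertex (φ 1) := fun φ =>
    (congrArg (stdSimplex.map φ) v1).trans (stdSimplex.map_vertex _ _)
  have h01 : p ![0, 1] 1 = p ![1, 2] 0 := by rw [p0, p1]; rfl
  refine homotopic_of_convex (convex_stdSimplex ℝ (Fin 3)) hS hpt (concat _ _ h01) (p ![0, 2])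
    ?_ ?_ (trans_map_eq h01 hα hβ) hγ
  · rw [concat_zero, p0, p0]; rfl
  · rw [concat_one, p1, p1]; rfl

/-- A reparametrization of a path is homotopic to it. -/
theorem homotopic_of_reparam {α β : MapPath f g} (p : C(I, I)) (h0 : p 0 = 0) (h1 : p 1 = 1)
    (h : ∀ x t, β.map x t = α.map x (p t)) : β.Homotopic α :=
  homotopic_of_convex (convex_Icc (0 : ℝ) 1) α.kcont α.map_sub p (.id I) h0 h1 h fun _ _ => rfl

theorem trans_const {α : MapPath f g} {β : MapPath g g} (hβ : ∀ x t, β.map x t = g x) :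
    (α.trans β).Homotopic α :=
  homotopic_of_reparam (concat (.id I) (.const I 1) rfl) (concat_zero _ _ _) (concat_one _ _ _)
    (trans_map_eq (S := α.map) (p := .id I) (q := .const I 1) rfl (fun _ _ => rfl) fun x t => by
      rw [hβ]; exact (α.target x).symm)

theorem const_trans {α : MapPath f f} {β : MapPath f g} (hα : ∀ x t, α.map x t = f x) :
    (α.trans β).Homotopic β :=
  homotopic_of_reparam (concat (.const I 0) (.id I) rfl) (concat_zero _ _ _) (concat_one _ _ _)
    (trans_map_eq (S := β.map) (p := .const I 0) (q := .id I) rfl (fun x t => by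
      rw [hα]; exact (β.source x).symm) fun _ _ => rfl)

theorem trans_assoc (α : MapPath f g) (β : MapPath g h) (γ : MapPath h k) :
    ((α.trans β).trans γ).Homotopic (α.trans (β.trans γ)) := by
  -- The three paths are run one after another over [0, 3], in unit time each. Both bracketings are
  -- then given by paths from 0 to 3 in this interval.
  let S : K → Icc (0 : ℝ) 3 → Z := fun x v =>
    if (v : ℝ) ≤ 1 then α.map x (projIcc 0 1 zero_le_one v) else
    if (v : ℝ) ≤ 2 then β.map x (projIcc 0 1 zero_le_one (v - 1)) else
      γ.map x (projIcc 0 1 zero_le_one (v - 2))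
  have hS : KContinuous fun z : K × Icc (0 : ℝ) 3 => S z.1 z.2 := by
    intro L u
    refine Continuous.if_le (α.kcont L ⟨fun z => ((u z).1, projIcc 0 1 zero_le_one
      ((u z).2 : ℝ)), by fun_prop⟩) (Continuous.if_le (β.kcont L ⟨fun z => ((u z).1,
      projIcc 0 1 zero_le_one ((u z).2 - 1 : ℝ)), by fun_prop⟩) (γ.kcont L ⟨fun z => ((u z).1,
      projIcc 0 1 zero_le_one ((u z).2 - 2 : ℝ)), by fun_prop⟩) (by fun_prop) (by fun_prop)
      fun z hz => ?_) (by fun_prop) (by fun_prop) fun z hz => ?_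
    · rw [hz, show (2 - 1 : ℝ) = 1 by norm_num, sub_self, projIcc_right, projIcc_left]
      exact (β.target _).trans (γ.source _).symm
    · rw [if_pos (by rw [hz]; norm_num), hz, sub_self, projIcc_right, projIcc_left]
      exact (α.target _).trans (β.source _).symm
  let a : ∀ i : ℝ, i ∈ Icc (0 : ℝ) 2 → C(I, Icc (0 : ℝ) 3) := fun i hi =>
    ⟨fun t => ⟨t + i, by linarith [hi.1, t.2.1], by linarith [hi.2, t.2.2]⟩, by fun_prop⟩
  have h0 : (0 : ℝ) ∈ Icc (0 : ℝ) 2 := by norm_num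
  have h1 : (1 : ℝ) ∈ Icc (0 : ℝ) 2 := by norm_num
  have h2 : (2 : ℝ) ∈ Icc (0 : ℝ) 2 := by norm_num
  have h01 : a 0 h0 1 = a 1 h1 0 := Subtype.ext (by simp [a])
  have h12 : a 1 h1 1 = a 2 h2 0 := Subtype.ext (by norm_num [a])
  have hα : ∀ x t, α.map x t = S x (a 0 h0 t) := fun x t => by
    have : (t : ℝ) ≤ 1 := t.2.2
    simp [S, a, this, projIcc_val]
  have hβ : ∀ x t, β.map x t = S x (a 1 h1 t) := fun x t => by
    -- At t = 0 the parameter is the breakpoint 1, where S still uses the branch of α; the two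
    -- branches agree there because α ends where β starts.
    rcases eq_or_lt_of_le t.2.1 with h | h
    · obtain rfl : t = 0 := Subtype.ext h.symm
      simp only [S, a, ContinuousMap.coe_mk, Icc.coe_zero, zero_add, le_refl, if_true]
      rw [projIcc_right]
      exact (β.source _).trans (α.target _).symm
    · have h3 : ¬ (t + 1 : ℝ) ≤ 1 := by linarith
      have h4 : (t + 1 : ℝ) ≤ 2 := by linarith [t.2.2]
      simp only [S, a, ContinuousMap.coe_mk, h3, h4, if_true, if_false, add_sub_cancel_right,
        projIcc_val]
  have hγ : ∀ x t, γ.map x t = S x (a 2 h2 t) := fun x t => by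
    have h3 : ¬ (t + 2 : ℝ) ≤ 1 := by linarith [t.2.1]
    rcases eq_or_lt_of_le t.2.1 with h | h
    · obtain rfl : t = 0 := Subtype.ext h.symm
      simp only [S, a, ContinuousMap.coe_mk, Icc.coe_zero, zero_add, le_refl, if_true,
        show ¬ (2 : ℝ) ≤ 1 by norm_num, if_false, show (2 - 1 : ℝ) = 1 by norm_num]
      rw [projIcc_right]
      exact (γ.source _).trans (β.target _).symm
    · have h4 : ¬ (t + 2 : ℝ) ≤ 2 := by linarith
      simp only [S, a, ContinuousMap.coe_mk, h3, h4, if_false, add_sub_cancel_right, projIcc_val]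
  have e1 : concat (a 0 h0) (a 1 h1) h01 1 = a 2 h2 0 := (concat_one _ _ _).trans h12
  have e2 : a 0 h0 1 = concat (a 1 h1) (a 2 h2) h12 0 := h01.trans (concat_zero _ _ _).symm
  refine homotopic_of_convex (convex_Icc (0 : ℝ) 3) hS (fun x v hx => ?_) (concat _ _ e1)
    (concat _ _ e2) ?_ ?_ (trans_map_eq e1 (trans_map_eq h01 hα hβ) hγ)
    (trans_map_eq e2 hα (trans_map_eq h12 hβ hγ))
  · simp only [S, α.map_sub _ _ hx, β.map_sub _ _ hx, γ.map_sub _ _ hx, ite_self]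
  · rw [concat_zero, concat_zero, concat_zero]
  · rw [concat_one, concat_one, concat_one]

end MapPath

/-! ### Interior points of disk bundles -/

section Interior

variable {V : Type} [NormedAddCommGroup V] [NormedSpace ℝ V] {H : Type} [TopologicalSpace H]
  {J : ModelWithCorners ℝ V H} {M : Type} [TopologicalSpace M] [ChartedSpace H M]
  {W : Type} [NormedAddCommGroup W] [NormedSpace ℝ W]

/-- At a boundary point of the convex set a nonzero supporting functional would be maximal along f,
so it would annihilate the image of the derivative, contrary to surjectivity. -/
theorem _root_.MDifferentiableAt.mem_interior_of_surjective_mfderiv {f : M → W} {m : M} {s : Set W}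
    (hf : MDifferentiableAt J 𝓘(ℝ, W) f m) (hs : Function.Surjective (mfderiv J 𝓘(ℝ, W) f m))
    (hm : J.IsInteriorPoint m) (hc : Convex ℝ s) (hcl : IsClosed s) (hne : (interior s).Nonempty)
    (hfs : ∀ m, f m ∈ s) : f m ∈ interior s := by
  have hf' := hf.differentiableWithinAt_writtenInExtChartAt.differentiableAt <| by
    simpa [← mem_interior_iff_mem_nhds] using! hm
  rw [hf.mfderiv] at hs
  replace hs : Function.Surjective (fderivWithin ℝ (writtenInExtChartAt J 𝓘(ℝ, W) m f) (range J)
    (extChartAt J m m)) := hs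
  rw [fderivWithin_eq_fderiv (J.uniqueDiffOn _ <| by simp) hf'] at hs
  have := hf'.mem_interior_convex_of_surjective_fderiv Filter.univ_mem hc hcl hne
    (fun v _ => hfs _) hs
  simpa using! this

variable {f : M → W} {h : W → M}

/-- A diffeomorphism to the closed disk preserves interior points. -/
theorem isInteriorPoint_iff_norm_lt (hf : ContMDiff J 𝓘(ℝ, W) ∞ f)
    (hh : ContMDiffOn 𝓘(ℝ, W) J ∞ h (Metric.closedBall 0 1))
    (hfm : ∀ m, f m ∈ Metric.closedBall (0 : W) 1) (hhf : ∀ m, h (f m) = m)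
    (hfh : ∀ v ∈ Metric.closedBall (0 : W) 1, f (h v) = v) (m : M) :
    J.IsInteriorPoint m ↔ ‖f m‖ < 1 := by
  have hi : interior (Metric.closedBall (0 : W) 1) = Metric.ball 0 1 :=
    interior_closedBall _ one_ne_zero
  have hfd : MDifferentiableAt J 𝓘(ℝ, W) f m := (hf m).mdifferentiableAt (by simp)
  have hhd := (hh (f m) (hfm m)).mdifferentiableWithinAt (by simp)
  constructor
  · intro hm
    -- The map h is smooth only within the closed ball, which may have f m on its sphere.
    -- Derivatives within the ball are still unique, since it is convex with nonempty interior; so f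
    -- ∘ h = id on the ball gives a right inverse of the derivative of f.
    have hu : UniqueMDiffWithinAt 𝓘(ℝ, W) (Metric.closedBall (0 : W) 1) (f m) :=
      (uniqueDiffOn_convex (convex_closedBall 0 1) (by rw [hi]; simp)).uniqueMDiffOn _ (hfm m)
    have hs : Function.Surjective (mfderiv J 𝓘(ℝ, W) f m) := by
      have hfd' : HasMFDerivAt J 𝓘(ℝ, W) f (h (f m)) (mfderiv J 𝓘(ℝ, W) f (h (f m))) := by
        refine MDifferentiableAt.hasMFDerivAt ?_
        rw [hhf]
        exact hfd
      have h1 := hfd'.comp_hasMFDerivWithinAt (f m) hhd.hasMFDerivWithinAt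
      have h2 := ((hasMFDerivAt_id (f m) : HasMFDerivAt 𝓘(ℝ, W) 𝓘(ℝ, W) id _ _).hasMFDerivWithinAt
        (s := Metric.closedBall (0 : W) 1)).congr_of_eventuallyEq (f₁ := f ∘ h)
        (eventually_nhdsWithin_of_forall fun v hv => hfh v hv) (hfh _ (hfm m))
      have h3 := hu.eq h1 h2
      -- Moves the derivative of f from the point h (f m) to the equal point m.
      have key : ∀ m' : M, m' = m → ∀ A : W →L[ℝ] V, (∀ w : W, (mfderiv J 𝓘(ℝ, W) f m' : V →L[ℝ] W) (A w) = w) →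
          Function.Surjective (mfderiv J 𝓘(ℝ, W) f m) := by
        rintro _ rfl A hA w
        exact ⟨A w, hA w⟩
      exact key _ (hhf m) (mfderivWithin 𝓘(ℝ, W) J h (Metric.closedBall 0 1) (f m))
        fun w => DFunLike.congr_fun h3 w
    have := hfd.mem_interior_of_surjective_mfderiv hs hm (convex_closedBall 0 1)
      Metric.isClosed_closedBall (by rw [hi]; simp) hfm
    rw [hi] at this
    simpa using this
  · intro hm
    -- Now f m has the ball as a neighbourhood, so h is differentiable there. From h ∘ f = id its
    -- derivative is surjective, and it sends the interior point f m of W to an interior point.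
    have hn : Metric.closedBall (0 : W) 1 ∈ 𝓝 (f m) :=
      mem_interior_iff_mem_nhds.1 (by rw [hi]; simpa using hm)
    have hhd' := hhd.mdifferentiableAt hn
    have h1 := hhd'.hasMFDerivAt.comp m hfd.hasMFDerivAt
    have e : h ∘ f = id := funext hhf
    rw [e] at h1
    have h2 := hasMFDerivAt_unique h1 (hasMFDerivAt_id m)
    have := hhd'.isInteriorPoint_of_surjective_mfderiv (fun v => ⟨mfderiv J 𝓘(ℝ, W) f m v,
      DFunLike.congr_fun h2 v⟩) BoundarylessManifold.isInteriorPoint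
    rwa [hhf] at this

end Interior

namespace OrthogonalDiskStructure

variable {E : SmoothBundle} (D : OrthogonalDiskStructure E) (Δ₀ Δ₁ : E.InteriorSection)

theorem isInteriorPoint_iff (i : E.idx) (k : D.idx) (e : E.total)
    (hi : E.proj e ∈ (E.triv i).baseSet) (hk : E.proj e ∈ (D.chart k).baseSet) :
    (E.fib i).model.IsInteriorPoint (E.triv i e).2 ↔
      ‖((D.chart k e).2 : EuclideanSpace ℝ (Fin (D.rank k)))‖ < 1 := by
  obtain ⟨h, hh, hv⟩ := D.smooth_symm i k
  let b : {b : E.base // b ∈ (E.triv i).baseSet ∧ b ∈ (D.chart k).baseSet} := ⟨E.proj e, hi, hk⟩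
  let f : E.fib i → EuclideanSpace ℝ (Fin (D.rank k)) := fun m =>
    ((D.chart k ((E.triv i).toOpenPartialHomeomorph.symm (b.1, m))).2 :)
  have hfe : f (E.triv i e).2 = (D.chart k e).2 := by
    simp only [f, b, (E.triv i).symm_apply_mk_proj ((E.triv i).mem_source.2 hi)]
  have hhv : ∀ v : disk (D.rank k), h b v =
    (E.triv i ((D.chart k).toOpenPartialHomeomorph.symm (b.1, v))).2 := hv b
  rw [← hfe]
  refine isInteriorPoint_iff_norm_lt (h := h b) (contMDiffOn_univ.1 ((D.smooth i k).1 b)) (hh.1 b)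
    (fun m => Subtype.prop _) (fun m => ?_) (fun v hv => ?_) _
  · simp only
    rw [hhv]
    have h1 := (D.chart k).symm_apply_mk_proj
      (x := (E.triv i).toOpenPartialHomeomorph.symm (b.1, m))
      ((D.chart k).mem_source.2 ((E.proj_symm hi m).symm ▸ hk))
    rw [E.proj_symm hi] at h1
    rw [h1, (E.triv i).apply_symm_apply' hi]
  · have h1 := (E.triv i).symm_apply_mk_proj
      (x := (D.chart k).toOpenPartialHomeomorph.symm (b.1, ⟨v, hv⟩))
      ((E.triv i).mem_source.2 (((D.chart k).proj_symm_apply' hk).symm ▸ hi))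
    rw [(D.chart k).proj_symm_apply' hk] at h1
    rw [hhv ⟨v, hv⟩]
    simp only
    rw [h1, (D.chart k).apply_symm_apply' hk]

/-- The fiberwise boundary is defined by the smooth trivializations; invariance of interior points
under diffeomorphism lets it be tested in any orthogonal disk chart. -/
theorem not_mem_boundary_iff (k : D.idx) (e : E.total) (hk : E.proj e ∈ (D.chart k).baseSet) :
    e ∉ E.boundary ↔ ‖((D.chart k e).2 : EuclideanSpace ℝ (Fin (D.rank k)))‖ < 1 := by
  constructor
  · intro h
    obtain ⟨i, hi⟩ := E.cover (E.proj e)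
    rw [← D.isInteriorPoint_iff i k e hi hk, ModelWithCorners.isInteriorPoint_iff_not_isBoundaryPoint]
    exact fun hb => h ⟨i, hi, hb⟩
  · rintro h ⟨i, hi, hb⟩
    rw [← D.isInteriorPoint_iff i k e hi hk,
      ModelWithCorners.isInteriorPoint_iff_not_isBoundaryPoint] at h
    exact h hb

/-- Both sections lie in the open ball in a disk chart, and the open ball is convex. This is what
makes E × I with the linear path an object of the category of sectioned disk bundles. -/
theorem linearPathIn_not_mem_boundary (k : D.idx) (b : E.base) (hk : b ∈ (D.chart k).baseSet)
    (t : I) : D.linearPathIn Δ₀ Δ₁ k b t ∉ E.boundary := by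
  have hp := D.proj_linearPathIn Δ₀ Δ₁ hk t
  have h1 : (D.chart k (D.linearPathIn Δ₀ Δ₁ k b t)).2 =
      lerp (D.chart k (Δ₀.map b)).2 (D.chart k (Δ₁.map b)).2 t := by
    rw [linearPathIn, (D.chart k).apply_symm_apply' hk]
  rw [D.not_mem_boundary_iff k _ (hp.symm ▸ hk), h1]
  have hΔ : ∀ Δ : E.InteriorSection, ((D.chart k (Δ.map b)).2 :
      EuclideanSpace ℝ (Fin (D.rank k))) ∈ Metric.ball 0 1 := fun Δ =>
    mem_ball_zero_iff.2 ((D.not_mem_boundary_iff k _ ((Δ.proj_map b).symm ▸ hk)).1 (Δ.not_mem b))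
  exact mem_ball_zero_iff.1 (convex_ball 0 1 (hΔ Δ₀) (hΔ Δ₁) (sub_nonneg.2 t.2.2) t.2.1 (by ring))

theorem linearPath_not_mem_boundary (z : E.base × I) :
    (D.linearPath Δ₀ Δ₁).map z ∉ E.boundary :=
  D.linearPathIn_not_mem_boundary Δ₀ Δ₁ (D.cover z.1).choose z.1 (D.cover z.1).choose_spec z.2

/-- The section `(b, t) ↦ ((1 - t) Δ₀(b) + t Δ₁(b), t)` of `E × I`. -/
noncomputable def linearSection : (E.times CompactPair.interval).InteriorSection where
  map := ⟨fun z => ((D.linearPath Δ₀ Δ₁).map z, z.2),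
    (D.linearPath Δ₀ Δ₁).map.continuous.prodMk continuous_snd⟩
  proj_map z := Prod.ext (D.proj_linearPathIn Δ₀ Δ₁ (D.cover z.1).choose_spec z.2) rfl
  not_mem z := by
    rintro ⟨i, hi, hb⟩
    exact D.linearPath_not_mem_boundary Δ₀ Δ₁ z ⟨i, hi.1, hb⟩

/-- The orthogonal disk bundle `E × X`. -/
def times (X : CompactPair) : OrthogonalDiskStructure (E.times X) where
  idx := D.idx
  rank := D.rank
  chart k := SmoothBundle.timesTriv (D.chart k) X
  cover b := (D.cover b.1).imp fun _ h => ⟨h, mem_univ _⟩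
  smooth i k := (D.smooth i k).reparam
    (r := fun b : {b : E.base × X // b ∈ (E.triv i).baseSet ×ˢ univ ∧
      b ∈ (D.chart k).baseSet ×ˢ univ} => ⟨b.1.1, b.2.1.1, b.2.2.1⟩) (by fun_prop)
  smooth_symm i k := by
    obtain ⟨h, hh, hv⟩ := D.smooth_symm i k
    let r : {b : E.base × X // b ∈ (E.triv i).baseSet ×ˢ univ ∧
      b ∈ (D.chart k).baseSet ×ˢ univ} → {b : E.base // b ∈ (E.triv i).baseSet ∧
        b ∈ (D.chart k).baseSet} := fun b => ⟨b.1.1, b.2.1.1, b.2.2.1⟩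
    exact ⟨fun b => h (r b), hh.reparam (r := r) (by fun_prop), fun b v => hv (r b) v⟩
  orthogonal k l b hk hl := by
    obtain ⟨A, hA⟩ := D.orthogonal k l b.1 hk.1 hl.1
    exact ⟨A, fun e he => hA e.1 (congrArg Prod.fst he)⟩

end OrthogonalDiskStructure

/-- The inclusion `E → E × I` at the time `t`. -/
def SmoothBundle.atTime (E : SmoothBundle) (t : I) : E ⟶ E.times CompactPair.interval where
  base := E.base.atTime t
  total := ⟨fun e => (e, t), by fun_prop⟩
  comm _ := rfl
  smooth i j := (E.transition i j).reparam
    (r := fun b : {b : E.base // b ∈ (E.triv i).baseSet ∧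
      (b, t) ∈ (E.triv j).baseSet ×ˢ (univ : Set I)} => ⟨b.1, b.2.1, b.2.2.1⟩) (by fun_prop)
  diffeo i j b hi hj := E.diffeo_id i j b hi hj.1

/-! ### Vertices and edges of simplicial transformations -/

theorem eq_mk₁ {𝒞 : Type 1} [Category.{0} 𝒞] (D : Fin 2 ⥤ 𝒞) :
    D = ComposableArrows.mk₁ (D.map (homOfLE (Fin.zero_le 1))) :=
  ComposableArrows.ext₁ rfl rfl ((Category.id_comp _).trans (Category.comp_id _)).symm

namespace SimplicialTransformation

variable {𝒞 : Type 1} [Category.{0} 𝒞] {F : 𝒞 ⥤ SpacePair} {P : Type} [TopologicalSpace P]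
  {G : 𝒞 ⥤ PointedSpace} (T : SimplicialTransformation F P G)

/-- Source and target of the map assigned to a simplex depend on the simplex, so equal simplices
first give a heterogeneous equality. -/
theorem app_congr {p : ℕ} {D D' : Fin (p + 1) ⥤ 𝒞} (h : D = D') {x : F.obj (D.obj 0)}
    {x' : F.obj (D'.obj 0)} (hx : HEq x x') (u : P) (t : stdSimplex ℝ (Fin (p + 1))) :
    HEq (T.app D x u t) (T.app D' x' u t) := by
  subst h
  obtain rfl := eq_of_heq hx
  rfl

theorem app_eq_mk₁ (D : Fin 2 ⥤ 𝒞) (x : F.obj (D.obj 0)) (u : P) (t : stdSimplex ℝ (Fin 2)) :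
    T.app D x u t = T.app (ComposableArrows.mk₁ (D.map (homOfLE (Fin.zero_le 1)))) x u t :=
  eq_of_heq (T.app_congr (eq_mk₁ D) HEq.rfl u t)

/-- The simplicial identity for the operator [1] → [p] with values i, j. -/
theorem app_edge {p : ℕ} (C : Fin (p + 1) ⥤ 𝒞) {i j : Fin (p + 1)} (h : i ≤ j)
    (x : F.obj (C.obj 0)) (u : P) (t : stdSimplex ℝ (Fin 2)) :
    T.app C x u (stdSimplex.map ![i, j] t) =
      (G.map (C.map (homOfLE (Fin.le_last j)))).map
        (T.app (ComposableArrows.mk₁ (C.map (homOfLE h)))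
          ((F.map (C.map (homOfLE (Fin.zero_le i)))).map x) u t) := by
  let α : Fin 2 →o Fin (p + 1) := ⟨![i, j], by
    rw [Fin.monotone_iff_le_succ]
    intro k
    fin_cases k
    exact h⟩
  refine (T.app_map C α x u t).trans ?_
  exact congrArg (G.map (C.map (homOfLE (Fin.le_last j)))).map
    (T.app_eq_mk₁ (α.monotone.functor ⋙ C) _ u t)

theorem app_vertex {p : ℕ} (C : Fin (p + 1) ⥤ 𝒞) (i : Fin (p + 1))
    (x : F.obj (C.obj 0)) (u : P) :
    T.app C x u (stdSimplex.vertex i) =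
      (G.map (C.map (homOfLE (Fin.le_last i)))).map
        (T.app (ComposableArrows.mk₀ (C.obj i))
          ((F.map (C.map (homOfLE (Fin.zero_le i)))).map x) u default) := by
  let α : Fin 1 →o Fin (p + 1) := ⟨fun _ => i, monotone_const⟩
  have h := T.app_map C α x u default
  have e : stdSimplex.map α default = stdSimplex.vertex (S := ℝ) i := by
    rw [Subsingleton.elim default (stdSimplex.vertex (0 : Fin 1)), stdSimplex.map_vertex]
    rfl
  rw [e] at h
  refine h.trans (congrArg (G.map (C.map (homOfLE (Fin.le_last i)))).map
    (eq_of_heq (T.app_congr (D := α.monotone.functor ⋙ C) (D' := ComposableArrows.mk₀ (C.obj i))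
      (ComposableArrows.ext₀ rfl) HEq.rfl u default)))

theorem app_mk₁_zero {X Y : 𝒞} (f : X ⟶ Y) (x : F.obj X) (u : P) :
    T.app (ComposableArrows.mk₁ f) x u (stdSimplexHomeomorphUnitInterval.symm 0) =
      (G.map f).map (T.app (ComposableArrows.mk₀ X) x u default) := by
  have e : stdSimplexHomeomorphUnitInterval.symm 0 = stdSimplex.vertex (S := ℝ) (0 : Fin 2) :=
    (Homeomorph.symm_apply_eq _).2 rfl
  rw [e]
  refine (T.app_vertex (ComposableArrows.mk₁ f) 0 x u).trans ?_
  change (G.map f).map (T.app (ComposableArrows.mk₀ X) ((F.map (𝟙 X)).map x) u default) = _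
  rw [F.map_id]
  rfl

theorem app_mk₁_one {X Y : 𝒞} (f : X ⟶ Y) (x : F.obj X) (u : P) :
    T.app (ComposableArrows.mk₁ f) x u (stdSimplexHomeomorphUnitInterval.symm 1) =
      T.app (ComposableArrows.mk₀ Y) ((F.map f).map x) u default := by
  have e : stdSimplexHomeomorphUnitInterval.symm 1 = stdSimplex.vertex (S := ℝ) (1 : Fin 2) :=
    (Homeomorph.symm_apply_eq _).2 rfl
  rw [e]
  refine (T.app_vertex (ComposableArrows.mk₁ f) 1 x u).trans ?_
  change (G.map (𝟙 Y)).map (T.app (ComposableArrows.mk₀ Y) ((F.map f).map x) u default) = _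
  rw [G.map_id]
  rfl

/-- The edge of an identity is degenerate: it comes from the vertex along [1] → [0], so its path is
constant. -/
theorem app_mk₁_id (X : 𝒞) (x : F.obj X) (u : P) (t : stdSimplex ℝ (Fin 2)) :
    T.app (ComposableArrows.mk₁ (𝟙 X)) x u t = T.app (ComposableArrows.mk₀ X) x u default := by
  let α : Fin 2 →o Fin 1 := ⟨fun _ => 0, monotone_const⟩
  have h := T.app_map (ComposableArrows.mk₀ X) α x u t
  rw [Subsingleton.elim (stdSimplex.map α t) default] at h
  refine Eq.trans ?_ h.symm
  change _ = (G.map (𝟙 X)).map (T.app (α.monotone.functor ⋙ ComposableArrows.mk₀ X)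
    ((F.map (𝟙 X)).map x) u t)
  rw [G.map_id, F.map_id]
  exact (T.app_eq_mk₁ (α.monotone.functor ⋙ ComposableArrows.mk₀ X) x u t).symm

end SimplicialTransformation

theorem map_comp_apply {𝒞 : Type 1} [Category.{0} 𝒞] (G : 𝒞 ⥤ PointedSpace) {X Y Z : 𝒞}
    (f : X ⟶ Y) (g : Y ⟶ Z) (x : G.obj X) :
    (G.map g).map ((G.map f).map x) = (G.map (f ≫ g)).map x := by
  rw [G.map_comp]
  rfl

theorem map_id_apply {𝒞 : Type 1} [Category.{0} 𝒞] (G : 𝒞 ⥤ PointedSpace) {X : 𝒞} (x : G.obj X) :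
    (G.map (𝟙 X)).map x = x := by
  rw [G.map_id]
  rfl

theorem map_id_apply' {𝒞 : Type 1} [Category.{0} 𝒞] (G : 𝒞 ⥤ SpacePair) {X : 𝒞} (x : G.obj X) :
    (G.map (𝟙 X)).map x = x := by
  rw [G.map_id]
  rfl

/-! ### The cylinder -/

/-- The map `(x, t) ↦ ω_L (x, ι t)`. -/
noncomputable def cyl {X : CompactPair} (x : L.obj X) (t : I) : L.obj (X.prod CompactPair.interval) :=
  Realization.cylinder X (x, t)

theorem continuous_cyl {X : CompactPair} :
    Continuous (fun z : L.obj X × I => (cyl z.1 z.2 : L.obj (X.prod CompactPair.interval))) :=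
  (Realization.cylinder X).continuous

/-- Together with `pr₂_cyl`, this exhibits `cyl x t` as ω_L(x, ι t): the axioms on ω_L are stated
for points of |X × I| through their two projections. -/
theorem pr₁_cyl {X : CompactPair} (x : L.obj X) (t : I) : pr₁ (cyl x t) = x :=
  Realization.map_fst_cylinder (X := X) (x, t)

theorem pr₂_cyl {X : CompactPair} (x : L.obj X) (t : I) : pr₂ (cyl x t) = iota t :=
  Realization.map_snd_cylinder (X := X) (x, t)

theorem cyl_zero {X : CompactPair} (x : L.obj X) : cyl x 0 = (L.map (X.atTime 0)).map x :=
  Realization.cylinder_zero (X := X) x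

theorem cyl_one {X : CompactPair} (x : L.obj X) : cyl x 1 = (L.map (X.atTime 1)).map x :=
  Realization.cylinder_one (X := X) x

/-- The cylinder map is natural for the inclusion A → X, so |A| × I goes to the image of |A × I|. -/
theorem cyl_sub {X : CompactPair} (x : L.obj X) (t : I) (hx : x ∈ (L.obj X).sub) :
    cyl x t ∈ (L.obj (X.prod CompactPair.interval)).sub := by
  obtain ⟨a, rfl⟩ := hx
  refine ⟨Realization.map ⟨fun z : X.sub × I => (⟨(z.1.1, z.2), Or.inl z.1.2⟩ :
    (X.prod CompactPair.interval).sub), by fun_prop⟩ (Realization.cylinder X.sub (a, t)), ?_⟩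
  rw [← Realization.map_comp]
  exact (Realization.cylinder_map (⟨Subtype.val, continuous_subtype_val⟩ : C(X.sub, X)) (a, t)).symm

/-- The projection `(X, A) × I → (X, A)`. -/
def CompactPair.projInterval (X : CompactPair) : X.prod interval ⟶ X where
  map := ⟨Prod.fst, continuous_fst⟩
  mapsTo _ h := h.resolve_right fun h => h

/-- The map from the interval to a point. -/
def CompactPair.intervalToPt : interval ⟶ pt where
  map := ⟨fun _ => ⟨⟩, continuous_const⟩
  mapsTo _ h := h

/-- The projection X × I → X factors through X × *, where the pairing is unital. This makes the edge
s = 0 of `muSquare` constant. -/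
theorem AugmentedMultiplicativeFunctor.projInterval_pairing (F : AugmentedMultiplicativeFunctor)
    {X : CompactPair} (x : F.F.obj X) (y : L.obj CompactPair.interval) :
    (F.F.map X.projInterval).map (F.pairing x y) = x := by
  have h := F.pairing_natural (𝟙 X) CompactPair.intervalToPt x y
  have e : CompactPair.prodMap (𝟙 X) CompactPair.intervalToPt ≫ X.unitor = X.projInterval := rfl
  rw [← e, ← map_comp_apply, h, F.pairing_unit, map_id_apply]

theorem AugmentedMultiplicativeFunctor.pairing_aug_iota (F : AugmentedMultiplicativeFunctor)
    {X : CompactPair} (x : L.obj X) (t : I) : F.pairing (F.aug x) (iota t) = F.aug (cyl x t) := by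
  have := F.aug_mul (cyl x t)
  rwa [pr₁_cyl, pr₂_cyl] at this

/-- The projection `(E, E|A) × I → (E, E|A)`. -/
def SmoothBundle.projInterval (E : SmoothBundle) :
    (E.times CompactPair.interval).totalPair ⟶ E.totalPair :=
  E.totalPair.projInterval

/-- The projection `(E, E|A) × * → (E, E|A)`. -/
def SmoothBundle.projPt (E : SmoothBundle) : (E.times CompactPair.pt).totalPair ⟶ E.totalPair :=
  E.totalPair.unitor

/-! ### The two squares of maps obtained from E × I. -/

namespace AbsoluteTransfer

variable {F : AugmentedMultiplicativeFunctor} (𝒯 : AbsoluteTransfer F) (E : SmoothBundle)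

/-- The homotopy `μ` for `(E, I)`, projected to `E`, as a square of maps. -/
noncomputable def muSquare (x : L.obj E.base) (t s : I) : F.F.obj E.totalPair :=
  (F.F.map E.projInterval).map
    (𝒯.μ.app (ComposableArrows.mk₀ (E, CompactPair.interval)) (x, iota t) s default)

theorem muSquare_kcont :
    KContinuous (fun z : L.obj E.base × I × I => 𝒯.muSquare E z.1 z.2.1 z.2.2) :=
  (F.F.map E.projInterval).kcont.comp
    ((𝒯.μ.kcont (ComposableArrows.mk₀ (E, CompactPair.interval))).comp
      (f := fun z : L.obj E.base × I × I => ((z.1, iota z.2.1), z.2.2, default))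
      ((continuous_fst.prodMk (continuous_iota.comp (by fun_prop))).prodMk
        (by fun_prop)).kContinuous)

theorem muSquare_sub (x : L.obj E.base) (t s : I) (hx : x ∈ (L.obj E.base).sub) :
    𝒯.muSquare E x t s = (F.F.obj E.totalPair).pt := by
  have h : (x, iota t) ∈ ((L.obj E.base).smash (L.obj CompactPair.interval)).sub := Or.inl hx
  exact (congrArg (F.F.map E.projInterval).map (𝒯.μ.app_sub
    (ComposableArrows.mk₀ (E, CompactPair.interval)) (x, iota t) s default h)).trans
    (F.F.map E.projInterval).map_pt

theorem muSquare_zero (x : L.obj E.base) (t : I) : 𝒯.muSquare E x t 0 = 𝒯.onBundle E x :=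
  (congrArg (F.F.map E.projInterval).map (𝒯.μ_zero (ComposableArrows.mk₀ (E, CompactPair.interval))
    x (iota t) default)).trans (F.projInterval_pairing _ _)

theorem muSquare_one (x : L.obj E.base) (t : I) : 𝒯.muSquare E x t 1 =
    (F.F.map E.projInterval).map (𝒯.onBundle (E.times CompactPair.interval) (cyl x t)) := by
  -- The axiom `μ_one` speaks of pairs (pr₁ w, pr₂ w). Generalizing the two entries allows w = `cyl
  -- x t` to be inserted by substitution.
  have h : ∀ (a : L.obj E.base) (b : L.obj CompactPair.interval), pr₁ (cyl x t) = a →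
      pr₂ (cyl x t) = b →
      𝒯.μ.app (ComposableArrows.mk₀ (E, CompactPair.interval)) (a, b) 1 default =
        𝒯.onBundle (E.times CompactPair.interval) (cyl x t) := by
    rintro _ _ rfl rfl
    exact 𝒯.μ_one (ComposableArrows.mk₀ (E, CompactPair.interval)) (cyl x t) default
  exact congrArg (F.F.map E.projInterval).map (h x (iota t) (pr₁_cyl x t) (pr₂_cyl x t))

/-- The path `μ(E, I)(x, ι t)`, projected to `E`. -/
noncomputable def muPath (t : I) : MapPath (K := L.obj E.base) (Z := F.F.obj E.totalPair)
    (𝒯.onBundle E) (fun x => (F.F.map E.projInterval).map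
      (𝒯.onBundle (E.times CompactPair.interval) (cyl x t))) where
  map x s := 𝒯.muSquare E x t s
  kcont := (𝒯.muSquare_kcont E).comp (f := fun z : L.obj E.base × I => (z.1, t, z.2))
    (by fun_prop : Continuous _).kContinuous
  map_sub x s hx := 𝒯.muSquare_sub E x t s hx
  source x := 𝒯.muSquare_zero E x t
  target x := 𝒯.muSquare_one E x t

theorem onBundle_kcont : KContinuous (𝒯.onBundle E) :=
  (𝒯.T.kcont (ComposableArrows.mk₀ E)).comp (f := fun x : L.obj E.base =>
    (x, PUnit.unit, (default : stdSimplex ℝ (Fin 1)))) (by fun_prop : Continuous _).kContinuous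

theorem onBundle_sub (x : L.obj E.base) (hx : x ∈ (L.obj E.base).sub) :
    𝒯.onBundle E x = (F.F.obj E.totalPair).pt :=
  𝒯.T.app_sub (ComposableArrows.mk₀ E) x ⟨⟩ default hx

/-- The path `T(E × I)(ω_L (x, ι t))`, `0 ≤ t ≤ 1`, projected to `E`. -/
noncomputable def cylPath : MapPath (K := L.obj E.base) (Z := F.F.obj E.totalPair)
    (fun x => (F.F.map E.projInterval).map
      (𝒯.onBundle (E.times CompactPair.interval) (cyl x 0)))
    (fun x => (F.F.map E.projInterval).map
      (𝒯.onBundle (E.times CompactPair.interval) (cyl x 1))) where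
  map x t := (F.F.map E.projInterval).map (𝒯.onBundle (E.times CompactPair.interval) (cyl x t))
  kcont := (F.F.map E.projInterval).kcont.comp ((𝒯.onBundle_kcont _).comp
    continuous_cyl.kContinuous)
  map_sub x t hx := (congrArg (F.F.map E.projInterval).map
    (𝒯.onBundle_sub (E.times CompactPair.interval) (cyl x t) (cyl_sub x t hx))).trans
    (F.F.map E.projInterval).map_pt
  source _ := rfl
  target _ := rfl

/-- The constant path. -/
def constPath {K : SpacePair} {Z : PointedSpace} (f : K → Z) (hf : KContinuous f)
    (h : ∀ x ∈ K.sub, f x = Z.pt) : MapPath f f where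
  map x _ := f x
  kcont := hf.comp continuous_fst.kContinuous
  map_sub x _ hx := h x hx
  source _ := rfl
  target _ := rfl

/-- The square `muSquare` has a constant edge at s = 0, so its remaining three edges form a
triangle. -/
theorem muPath_trans_cylPath : ((𝒯.muPath E 0).trans (𝒯.cylPath E)).Homotopic (𝒯.muPath E 1) := by
  refine (MapPath.homotopic_of_square (𝒯.muSquare_kcont E) (fun x t s hx => 𝒯.muSquare_sub E x t s hx)
    (α := constPath _ (𝒯.onBundle_kcont E) (𝒯.onBundle_sub E)) (β := 𝒯.muPath E 1)
    (γ := 𝒯.muPath E 0) (δ := 𝒯.cylPath E) (fun x t => (𝒯.muSquare_zero E x t).symm)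
    (fun _ _ => rfl) (fun _ _ => rfl) (fun x t => (𝒯.muSquare_one E x t).symm)).symm.trans ?_
  exact MapPath.const_trans fun _ _ => rfl

section Morphism

variable {E} {E' : SmoothBundle}

/-- The path `T(f)`, composed with a left inverse of `f`. -/
noncomputable def edgePath (f : E ⟶ E') (q : E'.totalPair ⟶ E.totalPair)
    (hq : SmoothBundle.totalFunctor.map f ≫ q = 𝟙 _) :
    MapPath (K := L.obj E.base) (Z := F.F.obj E.totalPair) (𝒯.onBundle E)
      (fun x => (F.F.map q).map (𝒯.onBundle E' ((L.map f.base).map x))) where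
  map x t := (F.F.map q).map (𝒯.T.app (ComposableArrows.mk₁ f) x ⟨⟩
    (stdSimplexHomeomorphUnitInterval.symm t))
  kcont := (F.F.map q).kcont.comp ((𝒯.T.kcont (ComposableArrows.mk₁ f)).comp
    (f := fun z : L.obj E.base × I => (z.1, PUnit.unit, stdSimplexHomeomorphUnitInterval.symm z.2))
    (by fun_prop : Continuous _).kContinuous)
  map_sub x t hx := (congrArg (F.F.map q).map (𝒯.T.app_sub (ComposableArrows.mk₁ f) x ⟨⟩
    (stdSimplexHomeomorphUnitInterval.symm t) hx)).trans (F.F.map q).map_pt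
  source x := by
    refine (congrArg (F.F.map q).map (𝒯.T.app_mk₁_zero f x ⟨⟩)).trans ?_
    refine (map_comp_apply F.F (SmoothBundle.totalFunctor.map f) q _).trans ?_
    rw [hq]
    exact map_id_apply F.F _
  target x := congrArg (F.F.map q).map (𝒯.T.app_mk₁_one f x ⟨⟩)

end Morphism

section Disk

variable {E} (D : OrthogonalDiskStructure E) (Δ₀ Δ₁ : E.InteriorSection)

/-- The disk bundle `E × I` with its section `(b, t) ↦ ((1 - t) Δ₀(b) + t Δ₁(b), t)`. -/
noncomputable def cylBundle : SectionedDiskBundle :=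
  ⟨E.times CompactPair.interval, ⟨D.times _⟩, D.linearSection Δ₀ Δ₁⟩

/-- The paths `𝐝(E × I)(ω_L (x, ι t))`, projected to `E`. -/
noncomputable def dSquare (x : L.obj E.base) (t s : I) : F.F.obj E.totalPair :=
  (F.F.map E.projInterval).map ((𝒯.dPath (cylBundle D Δ₀ Δ₁)).map (cyl x t) s)

theorem dSquare_kcont :
    KContinuous (fun z : L.obj E.base × I × I => 𝒯.dSquare D Δ₀ Δ₁ z.1 z.2.1 z.2.2) :=
  (F.F.map E.projInterval).kcont.comp ((𝒯.dPath (cylBundle D Δ₀ Δ₁)).kcont.comp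
    (f := fun z : L.obj E.base × I × I =>
      ((cyl z.1 z.2.1, z.2.2) : L.obj (E.base.prod CompactPair.interval) × I))
    ((continuous_cyl.comp (by fun_prop : Continuous fun z : L.obj E.base × I × I =>
      (z.1, z.2.1))).prodMk (by fun_prop)).kContinuous)

theorem dSquare_sub (x : L.obj E.base) (t s : I) (hx : x ∈ (L.obj E.base).sub) :
    𝒯.dSquare D Δ₀ Δ₁ x t s = (F.F.obj E.totalPair).pt := by
  exact (congrArg (F.F.map E.projInterval).map ((𝒯.dPath (cylBundle D Δ₀ Δ₁)).map_sub (cyl x t) s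
    (cyl_sub x t hx))).trans (F.F.map E.projInterval).map_pt

theorem dSquare_zero (x : L.obj E.base) (t : I) : 𝒯.dSquare D Δ₀ Δ₁ x t 0 =
    (F.F.map E.projInterval).map (𝒯.onBundle (E.times CompactPair.interval) (cyl x t)) :=
  congrArg _ ((𝒯.dPath (cylBundle D Δ₀ Δ₁)).source _)

/-- The disk bundle path on E × I ends at F(linear section) ε. The linear section followed by the
projection to E is φ, and ε(ω_L(x, ι t)) = ω_F(ε x, ι t). -/
theorem dSquare_one (x : L.obj E.base) (t : I) : 𝒯.dSquare D Δ₀ Δ₁ x t 1 =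
    F.hat (D.linearPath Δ₀ Δ₁) (F.aug x) t := by
  refine (congrArg (F.F.map E.projInterval).map
    ((𝒯.dPath (cylBundle D Δ₀ Δ₁)).target (cyl x t))).trans ?_
  rw [AugmentedMultiplicativeFunctor.hat, F.pairing_aug_iota]
  exact map_comp_apply F.F (D.linearSection Δ₀ Δ₁).pairMap E.projInterval (F.aug (cyl x t))

theorem hat_aug_eq {t : I} {Δ : E.InteriorSection}
    (ht : ∀ x : L.obj E.base, cyl x t = (L.map (E.base.atTime t)).map x)
    (hΔ : E.base.atTime t ≫ D.linearPath Δ₀ Δ₁ = Δ.pairMap) (x : L.obj E.base) :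
    F.hat (D.linearPath Δ₀ Δ₁) (F.aug x) t = (F.F.map Δ.pairMap).map (F.aug x) := by
  rw [AugmentedMultiplicativeFunctor.hat, F.pairing_aug_iota, ht, ← F.aug_natural, map_comp_apply, hΔ]

variable {Δ₀ Δ₁} in
/-- The path `𝐝(E × I)(ω_L (x, ι t))` at an end `t` of the interval, projected to `E`. -/
noncomputable def dEndPath {t : I} {Δ : E.InteriorSection}
    (ht : ∀ x : L.obj E.base, cyl x t = (L.map (E.base.atTime t)).map x)
    (hΔ : E.base.atTime t ≫ D.linearPath Δ₀ Δ₁ = Δ.pairMap) :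
    MapPath (K := L.obj E.base) (Z := F.F.obj E.totalPair)
      (fun x => (F.F.map E.projInterval).map
        (𝒯.onBundle (E.times CompactPair.interval) (cyl x t)))
      (fun x => (F.F.map Δ.pairMap).map (F.aug x)) where
  map x s := 𝒯.dSquare D Δ₀ Δ₁ x t s
  kcont := (𝒯.dSquare_kcont D Δ₀ Δ₁).comp (f := fun z : L.obj E.base × I => (z.1, t, z.2))
    (by fun_prop : Continuous _).kContinuous
  map_sub x s hx := 𝒯.dSquare_sub D Δ₀ Δ₁ x t s hx
  source x := 𝒯.dSquare_zero D Δ₀ Δ₁ x t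
  target x := (𝒯.dSquare_one D Δ₀ Δ₁ x t).trans (hat_aug_eq D Δ₀ Δ₁ ht hΔ x)

/-- The boundary of `dSquare`: its edges in the direction t are `cylPath` and F̂(φ)(ε ∧ 1). -/
theorem cylPath_trans_dEndPath :
    ((𝒯.cylPath E).trans (𝒯.dEndPath D cyl_one (D.linearPath_one Δ₀ Δ₁))).Homotopic
      ((𝒯.dEndPath D cyl_zero (D.linearPath_zero Δ₀ Δ₁)).trans
        (F.hatPath (D.linearPath Δ₀ Δ₁) (D.linearPath_zero Δ₀ Δ₁) (D.linearPath_one Δ₀ Δ₁))) :=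
  MapPath.homotopic_of_square (𝒯.dSquare_kcont D Δ₀ Δ₁)
    (fun x t s hx => 𝒯.dSquare_sub D Δ₀ Δ₁ x t s hx)
    (fun x t => (𝒯.dSquare_zero D Δ₀ Δ₁ x t).symm) (fun _ _ => rfl) (fun _ _ => rfl)
    (fun x t => (𝒯.dSquare_one D Δ₀ Δ₁ x t).symm)

end Disk

end AbsoluteTransfer

/-- A path with equal end points. -/
def MapPath.copy {K : SpacePair} {Z : PointedSpace} {f g f' g' : K → Z} (α : MapPath f g)
    (hf : ∀ x, f x = f' x) (hg : ∀ x, g x = g' x) : MapPath f' g' where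
  map := α.map
  kcont := α.kcont
  map_sub := α.map_sub
  source x := (α.source x).trans (hf x)
  target x := (α.target x).trans (hg x)

/-! ### The ends of the cylinder: recovering 𝐝(E, Δ) from E × I. -/

namespace AbsoluteTransfer

variable {F : AugmentedMultiplicativeFunctor} (𝒯 : AbsoluteTransfer F)

section DiskEnd

variable {E : SmoothBundle} (D : OrthogonalDiskStructure E) {Δ₀ Δ₁ Δ : E.InteriorSection} {t : I}
  (ht : ∀ x : L.obj E.base, cyl x t = (L.map (E.base.atTime t)).map x)
  (hΔ : E.base.atTime t ≫ D.linearPath Δ₀ Δ₁ = Δ.pairMap)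

/-- The inclusion of `E` into `E × I` at an end, as a morphism of disk bundles with sections. -/
noncomputable def cylInclusion : (⟨E, ⟨D⟩, Δ⟩ : SectionedDiskBundle) ⟶ cylBundle D Δ₀ Δ₁ where
  hom := E.atTime t
  comm b := Prod.ext (DFunLike.congr_fun (congrArg CompactPair.Hom.map hΔ) b).symm rfl

/-- The path `T(E → E × I)` for the inclusion at the time `t`, projected to `E`. -/
noncomputable def endPath : MapPath (K := L.obj E.base) (Z := F.F.obj E.totalPair) (𝒯.onBundle E)
    (fun x => (F.F.map E.projInterval).map
      (𝒯.onBundle (E.times CompactPair.interval) (cyl x t))) :=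
  (𝒯.edgePath (E.atTime t) E.projInterval rfl).copy (fun _ => rfl) fun x =>
    congrArg (fun y => (F.F.map E.projInterval).map
      (𝒯.onBundle (E.times CompactPair.interval) y)) (ht x).symm

/-- Evaluate 𝐝 on the edge (E, Δ) → (E × I, linear section), with r along the edge and s along the
homotopy. The side s = 1 is constant because 𝐝 ends at a strict natural transformation. -/
theorem endPath_trans_dEndPath :
    ((𝒯.endPath ht).trans (𝒯.dEndPath D ht hΔ)).Homotopic (𝒯.dPath ⟨E, ⟨D⟩, Δ⟩) := by
  let a := cylInclusion D hΔ
  let S : L.obj E.base → I → I → F.F.obj E.totalPair := fun x r s =>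
    (F.F.map E.projInterval).map
      (𝒯.d.app (ComposableArrows.mk₁ a) x s (stdSimplexHomeomorphUnitInterval.symm r))
  have hS : KContinuous fun z : L.obj E.base × I × I => S z.1 z.2.1 z.2.2 :=
    (F.F.map E.projInterval).kcont.comp ((𝒯.d.kcont (ComposableArrows.mk₁ a)).comp
      (f := fun z : L.obj E.base × I × I =>
        (z.1, z.2.2, stdSimplexHomeomorphUnitInterval.symm z.2.1))
      (by fun_prop : Continuous _).kContinuous)
  have hsub : ∀ x r s, x ∈ (L.obj E.base).sub → S x r s = (F.F.obj E.totalPair).pt :=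
    fun x r s hx => (congrArg (F.F.map E.projInterval).map (𝒯.d.app_sub (ComposableArrows.mk₁ a) x s
      (stdSimplexHomeomorphUnitInterval.symm r) hx)).trans (F.F.map E.projInterval).map_pt
  have h1 : ∀ x r, (𝒯.endPath ht).map x r = S x r 0 := fun x r =>
    congrArg (F.F.map E.projInterval).map (((𝒯.d_zero (ComposableArrows.mk₁ a) x
      (stdSimplexHomeomorphUnitInterval.symm r)).trans (𝒯.T.app_eq_mk₁
        (ComposableArrows.mk₁ a ⋙ SectionedDiskBundle.forget) x ⟨⟩
        (stdSimplexHomeomorphUnitInterval.symm r))).symm)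
  have h2 : ∀ x s, (𝒯.dEndPath D ht hΔ).map x s = S x 1 s := fun x s => by
    refine Eq.trans ?_ (congrArg (F.F.map E.projInterval).map (𝒯.d.app_mk₁_one a x s)).symm
    exact congrArg (fun y => (F.F.map E.projInterval).map
      ((𝒯.dPath (cylBundle D Δ₀ Δ₁)).map y s)) (ht x)
  -- At r = 0 the path 𝐝(E, Δ) is pushed forward along E → E × I and projected back to E, which
  -- changes nothing.
  have h3 : ∀ x s, (𝒯.dPath ⟨E, ⟨D⟩, Δ⟩).map x s = S x 0 s := fun x s => by
    refine Eq.symm ((congrArg (F.F.map E.projInterval).map (𝒯.d.app_mk₁_zero a x s)).trans ?_)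
    exact (map_comp_apply F.F (SmoothBundle.totalFunctor.map (E.atTime t)) E.projInterval _).trans
      (map_id_apply F.F _)
  have h4 : ∀ x r, (F.F.map Δ.pairMap).map (F.aug x) = S x r 1 := fun x r => by
    refine Eq.symm ((congrArg (F.F.map E.projInterval).map (𝒯.d_one (ComposableArrows.mk₁ a) x
      (stdSimplexHomeomorphUnitInterval.symm r))).trans ?_)
    refine (map_comp_apply F.F (D.linearSection Δ₀ Δ₁).pairMap E.projInterval
      (F.aug ((L.map (E.base.atTime t)).map x))).trans ?_
    change (F.F.map (D.linearPath Δ₀ Δ₁)).map (F.aug ((L.map (E.base.atTime t)).map x)) = _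
    rw [← F.aug_natural, map_comp_apply, ← hΔ]
  refine (MapPath.homotopic_of_square hS hsub (δ := constPath _
    ((F.F.map Δ.pairMap).kcont.comp F.aug_kcont) fun x hx => ?_) h1 h2 h3 h4).trans
    (MapPath.trans_const fun _ _ => rfl)
  exact (congrArg (F.F.map Δ.pairMap).map (F.aug_sub x hx)).trans (F.F.map Δ.pairMap).map_pt

end DiskEnd

/-! ### Normality of μ and the inclusions E → E × * → E × I. -/

section Normality

variable {E : SmoothBundle} {t : I}
  (ht : ∀ x : L.obj E.base, cyl x t = (L.map (E.base.atTime t)).map x)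

/-- The inclusion `E × * → E × I` at the time `t`. -/
def ptInclusion (E : SmoothBundle) (t : I) :
    E.times CompactPair.pt ⟶ E.times CompactPair.interval :=
  SmoothBundle.timesMap (𝟙 E) (CompactPair.point t)

/-- The map `L(E) → L(E × *)`. -/
noncomputable def toPt (x : L.obj E.base) : L.obj (E.base.prod CompactPair.pt) :=
  (L.map (SmoothBundle.toTimesPt.app E).base).map x

/-- The path `T(E → E × *)`, projected to `E`. -/
noncomputable def ptPath (E : SmoothBundle) :
    MapPath (K := L.obj E.base) (Z := F.F.obj E.totalPair) (𝒯.onBundle E) fun x =>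
      (F.F.map E.projPt).map (𝒯.onBundle (E.times CompactPair.pt) (toPt x)) :=
  𝒯.edgePath (SmoothBundle.toTimesPt.app E) E.projPt rfl

theorem toPt_sub (x : L.obj E.base) (hx : x ∈ (L.obj E.base).sub) :
    toPt x ∈ (L.obj (E.base.prod CompactPair.pt)).sub :=
  (L.map (SmoothBundle.toTimesPt.app E).base).mapsTo hx

theorem pr₁_toPt (x : L.obj E.base) : pr₁ (toPt x) = x :=
  (Realization.map_comp _ _ x).symm.trans (Realization.map_id _ x)

theorem map_point_pr₂_toPt (x : L.obj E.base) :
    (L.map (CompactPair.point t)).map (pr₂ (toPt x)) = pr₂ ((L.map (E.base.atTime t)).map x) := by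
  refine (Realization.map_comp (X := E.base.prod CompactPair.pt) (Y := PUnit) (Z := I) ⟨Prod.snd, continuous_snd⟩
    (CompactPair.point t).map (toPt x)).symm.trans ?_
  refine (Realization.map_comp (X := E.base) (Y := E.base.prod CompactPair.pt) _ _ x).symm.trans ?_
  exact Realization.map_comp (X := E.base) (Y := E.base.prod CompactPair.interval) (Z := I)
    (E.base.atTime t).map ⟨Prod.snd, continuous_snd⟩ x

/-- The path `T(E × * → E × I)`, projected to `E`. -/
noncomputable def ptInclusionPath : MapPath (K := L.obj E.base) (Z := F.F.obj E.totalPair)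
    (fun x => (F.F.map E.projPt).map (𝒯.onBundle (E.times CompactPair.pt) (toPt x)))
    (fun x => (F.F.map E.projInterval).map
      (𝒯.onBundle (E.times CompactPair.interval) (cyl x t))) where
  map x r := (F.F.map E.projInterval).map (𝒯.T.app (ComposableArrows.mk₁ (ptInclusion E t))
    (toPt x) ⟨⟩ (stdSimplexHomeomorphUnitInterval.symm r))
  kcont := (F.F.map E.projInterval).kcont.comp ((𝒯.T.kcont
    (ComposableArrows.mk₁ (ptInclusion E t))).comp
      (f := fun z : L.obj E.base × I =>
        ((toPt z.1, PUnit.unit, stdSimplexHomeomorphUnitInterval.symm z.2) :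
          L.obj (E.base.prod CompactPair.pt) × PUnit × stdSimplex ℝ (Fin 2)))
      (((L.map (SmoothBundle.toTimesPt.app E).base).kcont.comp continuous_fst.kContinuous).prodMk
        (by fun_prop : Continuous _).kContinuous))
  map_sub x r hx := (congrArg (F.F.map E.projInterval).map (𝒯.T.app_sub
    (ComposableArrows.mk₁ (ptInclusion E t)) (toPt x) ⟨⟩
    (stdSimplexHomeomorphUnitInterval.symm r) (toPt_sub x hx))).trans
    (F.F.map E.projInterval).map_pt
  source x := by
    refine (congrArg (F.F.map E.projInterval).map
      (𝒯.T.app_mk₁_zero (ptInclusion E t) (toPt x) ⟨⟩)).trans ?_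
    exact map_comp_apply F.F (SmoothBundle.totalFunctor.map (ptInclusion E t)) E.projInterval _
  target x := by
    refine (congrArg (F.F.map E.projInterval).map
      (𝒯.T.app_mk₁_one (ptInclusion E t) (toPt x) ⟨⟩)).trans ?_
    refine congrArg (fun y => (F.F.map E.projInterval).map
      (𝒯.onBundle (E.times CompactPair.interval) y)) (Eq.trans ?_ (ht x).symm)
    exact (Realization.map_comp (X := E.base) (Y := E.base.prod CompactPair.pt)
      (Z := E.base.prod CompactPair.interval) _ (ptInclusion E t).base.map x).symm

/-- T on the 2-simplex E → E × * → E × I, whose long edge is the inclusion E → E × I at the time t.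
-/
theorem ptPath_trans_ptInclusionPath :
    ((𝒯.ptPath E).trans (𝒯.ptInclusionPath ht)).Homotopic (𝒯.endPath ht) := by
  let C := ComposableArrows.mk₂ (SmoothBundle.toTimesPt.app E) (ptInclusion E t)
  refine MapPath.homotopic_of_triangle (K := L.obj E.base) (Z := F.F.obj E.totalPair)
    (S := fun x r => (F.F.map E.projInterval).map (𝒯.T.app C x ⟨⟩ r))
    ((F.F.map E.projInterval).kcont.comp ((𝒯.T.kcont C).comp
      (f := fun z : L.obj E.base × stdSimplex ℝ (Fin 3) => (z.1, PUnit.unit, z.2))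
      (by fun_prop : Continuous _).kContinuous))
    (fun x r hx => (congrArg (F.F.map E.projInterval).map (𝒯.T.app_sub C x ⟨⟩ r hx)).trans
      (F.F.map E.projInterval).map_pt) (fun x r => ?_) (fun x r => ?_) (fun x r => ?_)
  · refine Eq.symm ((congrArg (F.F.map E.projInterval).map (𝒯.T.app_edge C
      (i := 0) (j := 1) (Fin.zero_le 1) x ⟨⟩ _)).trans ?_)
    refine (map_comp_apply F.F (SmoothBundle.totalFunctor.map (ptInclusion E t)) E.projInterval
      _).trans ?_
    refine congrArg (fun y => (F.F.map E.projPt).map (𝒯.T.app (ComposableArrows.mk₁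
      (SmoothBundle.toTimesPt.app E)) y ⟨⟩ (stdSimplexHomeomorphUnitInterval.symm r))) ?_
    exact map_id_apply' bundleL x
  · refine Eq.symm ((congrArg (F.F.map E.projInterval).map (𝒯.T.app_edge C
      (i := 1) (j := 2) (Fin.le_last 1) x ⟨⟩ _)).trans ?_)
    exact congrArg (F.F.map E.projInterval).map (map_id_apply F.onBundles _)
  · refine Eq.symm ((congrArg (F.F.map E.projInterval).map (𝒯.T.app_edge C
      (i := 0) (j := 2) (Fin.zero_le 2) x ⟨⟩ _)).trans ?_)
    refine congrArg (F.F.map E.projInterval).map ((map_id_apply F.onBundles _).trans ?_)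
    exact congrArg (fun y => 𝒯.T.app (ComposableArrows.mk₁ (E.atTime t)) y ⟨⟩
      (stdSimplexHomeomorphUnitInterval.symm r)) (map_id_apply' bundleL x)

/-- The prism over the vertex E is the single edge E → E × *. Normality is applied to this edge
itself, with γ₁ the identity and γ₂ constant, so s becomes the parameter along T(E → E × *). -/
theorem μ_pt_app (x : L.obj E.base) (y : L.obj CompactPair.pt) (s : I) :
    (F.F.map E.projPt).map (𝒯.μ.app (ComposableArrows.mk₀ (E, CompactPair.pt)) (x, y) s default) =
      (𝒯.ptPath E).map x s := by
  have h := 𝒯.μ_unit (ComposableArrows.mk₀ E) (OrderHom.id) (⟨fun _ => 0, monotone_const⟩ :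
    Fin 2 →o Fin 1) x y (stdSimplexHomeomorphUnitInterval.symm s)
  have e1 : stdSimplexHomeomorphUnitInterval (stdSimplex.map (OrderHom.id : Fin 2 →o Fin 2)
      (stdSimplexHomeomorphUnitInterval.symm s)) = s :=
    (congrArg _ (stdSimplex.map_id_apply _)).trans (Homeomorph.apply_symm_apply _ _)
  rw [e1, Subsingleton.elim (stdSimplex.map _ _) default] at h
  refine congrArg (F.F.map E.projPt).map (h.trans ?_)
  let D := (OrderHom.id : Fin 2 →o Fin 2).monotone.functor.prod'
    (⟨fun _ => 0, monotone_const⟩ : Fin 2 →o Fin 1).monotone.functor ⋙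
      unitPrism (ComposableArrows.mk₀ E)
  refine (map_id_apply F.onBundles _).trans ?_
  refine (congrArg (fun y => 𝒯.T.app D y ⟨⟩ (stdSimplexHomeomorphUnitInterval.symm s))
    (map_id_apply' bundleL x)).trans ?_
  exact 𝒯.T.app_eq_mk₁ D x ⟨⟩ (stdSimplexHomeomorphUnitInterval.symm s)

/-- Evaluate μ on the edge (E, *) → (E, I) given by the point t. Normality identifies the side r = 0
with `ptPath`, the side r = 1 is `muPath t`, and the side s = 1 is T(E × * → E × I). -/
theorem ptPath_trans_muSquare :
    ((𝒯.ptPath E).trans (𝒯.ptInclusionPath ht)).Homotopic (𝒯.muPath E t) := by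
  let a : (E, CompactPair.pt) ⟶ (E, CompactPair.interval) := Prod.mkHom (𝟙 E) (CompactPair.point t)
  -- The point of L(*) is taken as the second projection of `toPt x`, so that `μ_one` applies to (x,
  -- y x) with w = `toPt x`.
  let y : L.obj E.base → L.obj CompactPair.pt := fun x => pr₂ (toPt x)
  have hy : ∀ x, (L.map (CompactPair.point t)).map (y x) = iota t := fun x => by
    rw [map_point_pr₂_toPt, ← ht, pr₂_cyl]
  have hyc : Continuous y := (Realization.map _).continuous.comp (Realization.map _).continuous
  let S : L.obj E.base → I → I → F.F.obj E.totalPair := fun x r s =>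
    (F.F.map E.projInterval).map
      (𝒯.μ.app (ComposableArrows.mk₁ a) (x, y x) s (stdSimplexHomeomorphUnitInterval.symm r))
  have hS : KContinuous fun z : L.obj E.base × I × I => S z.1 z.2.1 z.2.2 :=
    (F.F.map E.projInterval).kcont.comp ((𝒯.μ.kcont (ComposableArrows.mk₁ a)).comp
      (f := fun z : L.obj E.base × I × I =>
        ((z.1, y z.1), z.2.2, stdSimplexHomeomorphUnitInterval.symm z.2.1))
      ((continuous_fst.prodMk (hyc.comp continuous_fst)).prodMk (by fun_prop)).kContinuous)
  have hsub : ∀ x r s, x ∈ (L.obj E.base).sub → S x r s = (F.F.obj E.totalPair).pt :=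
    fun x r s hx => by
      have h : (x, y x) ∈ ((L.obj E.base).smash (L.obj CompactPair.pt)).sub := Or.inl hx
      exact (congrArg (F.F.map E.projInterval).map (𝒯.μ.app_sub (ComposableArrows.mk₁ a) (x, y x) s
        (stdSimplexHomeomorphUnitInterval.symm r) h)).trans (F.F.map E.projInterval).map_pt
  have h1 : ∀ x r, 𝒯.onBundle E x = S x r 0 := fun x r => by
    refine Eq.symm ((congrArg (F.F.map E.projInterval).map (𝒯.μ_zero (ComposableArrows.mk₁ a) x (y x)
      (stdSimplexHomeomorphUnitInterval.symm r))).trans ?_)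
    refine (F.projInterval_pairing _ _).trans ?_
    -- The first component of the edge is the identity of E, a degenerate simplex, so T is constant
    -- along it.
    refine (𝒯.T.app_eq_mk₁ (ComposableArrows.mk₁ a ⋙ CategoryTheory.Prod.fst _ _) x ⟨⟩ _).trans ?_
    exact 𝒯.T.app_mk₁_id E x ⟨⟩ _
  have h2 : ∀ x s, (𝒯.muPath E t).map x s = S x 1 s := fun x s => by
    refine Eq.symm ((congrArg (F.F.map E.projInterval).map (𝒯.μ.app_mk₁_one a (x, y x) s)).trans ?_)
    have e : (bundleLL.map a).map (x, y x) =
        ((x, iota t) : (L.obj E.base).smash (L.obj CompactPair.interval)) :=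
      Prod.ext (map_id_apply' L x) (hy x)
    exact congrArg (fun z => (F.F.map E.projInterval).map
      (𝒯.μ.app (ComposableArrows.mk₀ (E, CompactPair.interval)) z s default)) e
  have h3 : ∀ x s, (𝒯.ptPath E).map x s = S x 0 s := fun x s => by
    refine Eq.symm ((congrArg (F.F.map E.projInterval).map (𝒯.μ.app_mk₁_zero a (x, y x) s)).trans ?_)
    refine Eq.trans ?_ (𝒯.μ_pt_app x (y x) s)
    exact map_comp_apply F.F (SmoothBundle.totalFunctor.map (ptInclusion E t)) E.projInterval _
  have h4 : ∀ x r, (𝒯.ptInclusionPath ht).map x r = S x r 1 := fun x r => by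
    have h : ∀ z : L.obj E.base, pr₁ (toPt x) = z → 𝒯.μ.app (ComposableArrows.mk₁ a) (z, y x) 1
        (stdSimplexHomeomorphUnitInterval.symm r) = 𝒯.T.app (ComposableArrows.mk₁ a ⋙
          SmoothBundle.timesFunctor) (toPt x) ⟨⟩ (stdSimplexHomeomorphUnitInterval.symm r) := by
      rintro _ rfl
      exact 𝒯.μ_one (ComposableArrows.mk₁ a) (toPt x) (stdSimplexHomeomorphUnitInterval.symm r)
    refine congrArg (F.F.map E.projInterval).map (Eq.symm ((h x (pr₁_toPt x)).trans ?_))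
    exact 𝒯.T.app_eq_mk₁ (ComposableArrows.mk₁ a ⋙ SmoothBundle.timesFunctor) (toPt x) ⟨⟩ _
  exact (MapPath.homotopic_of_square hS hsub (α := constPath _ (𝒯.onBundle_kcont E)
    (𝒯.onBundle_sub E)) h1 h2 h3 h4).symm.trans (MapPath.const_trans fun _ _ => rfl)

end Normality

/-- Both `muPath t` and `endPath` are homotopic to T(E → E × *) followed by T(E × * → E × I), so one
may replace the other in `endPath_trans_dEndPath`. -/
theorem muPath_trans_dEndPath {E : SmoothBundle} (D : OrthogonalDiskStructure E)
    {Δ₀ Δ₁ Δ : E.InteriorSection} {t : I}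
    (ht : ∀ x : L.obj E.base, cyl x t = (L.map (E.base.atTime t)).map x)
    (hΔ : E.base.atTime t ≫ D.linearPath Δ₀ Δ₁ = Δ.pairMap) :
    ((𝒯.muPath E t).trans (𝒯.dEndPath D ht hΔ)).Homotopic (𝒯.dPath ⟨E, ⟨D⟩, Δ⟩) :=
  (((𝒯.ptPath_trans_muSquare ht).symm.trans (𝒯.ptPath_trans_ptInclusionPath ht)).trans_congr
    (.refl _)).trans (𝒯.endPath_trans_dEndPath D ht hΔ)

end AbsoluteTransfer

end RefinedTransfer

theorem mainTheorem6 (F : AugmentedMultiplicativeFunctor) (𝒯 : AbsoluteTransfer F)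
    (E : SmoothBundle) (D : OrthogonalDiskStructure E) (Δ₀ Δ₁ : E.InteriorSection) :
    ((𝒯.dPath ⟨E, ⟨D⟩, Δ₀⟩).trans
      (F.hatPath (D.linearPath Δ₀ Δ₁) (D.linearPath_zero Δ₀ Δ₁) (D.linearPath_one Δ₀ Δ₁))).Homotopic
      (𝒯.dPath ⟨E, ⟨D⟩, Δ₁⟩) := by
  have h0 := 𝒯.muPath_trans_dEndPath D cyl_zero (D.linearPath_zero Δ₀ Δ₁)
  have h1 := 𝒯.muPath_trans_dEndPath D cyl_one (D.linearPath_one Δ₀ Δ₁)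
  -- Both disk bundle paths are replaced by `muPath` followed by `dEndPath`. After reassociating,
  -- the square of 𝐝 moves the path of φ across to `cylPath`, and the square of μ absorbs `cylPath`
  -- into `muPath 1`.
  refine (h0.symm.trans_congr (.refl _)).trans (.trans ?_ h1)
  refine (MapPath.trans_assoc _ _ _).trans ?_
  refine (MapPath.Homotopic.trans_congr (.refl _) (𝒯.cylPath_trans_dEndPath D Δ₀ Δ₁).symm).trans ?_
  refine (MapPath.trans_assoc _ _ _).symm.trans ?_
  exact (𝒯.muPath_trans_cylPath E).trans_congr (.refl _)
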